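/- **Setting.** Let $A_1,\dots,A_k$ be countably infinite torsion-free groups, let $F_N$ be a free group of rank $N$, let $G=A_1*\cdots*A_k*F_N$ and $\mathcal A=\{[A_1],\dots,[A_k]\}$, and assume that $(G,\mathcal A)$ is non-sporadic, i.e. $2k+3N-3\ge 3$. A subgroup of $G$ is *peripheral* if it is conjugate into some $A_i$; an element is *non-peripheral* if it is nontrivial and not conjugate into any $A_i$. A *$(G,\mathcal A)$-tree* is a metric simplicial tree, not a single point, with a minimal cocompact isometric action of $G$ without inversions, such that every peripheral subgroup fixes a point, and such that at each vertex of degree two some element of $G$ fixes the vertex and interchanges the two incident edges; such trees are considered up to $G$-equivariant isometry. An element is *elliptic* if it fixes a point. A *collapse* is a continuous $G$-equivariant map between such trees with connected (nonempty) point preimages; two trees $T_0,T_1$ are *compatible* if some $(G,\mathcal A)$-tree collapses to both. * A *Grushko tree* is a $(G,\mathcal A)$-tree with trivial edge stabilizers in which every elliptic element is peripheral (the identity being regarded as peripheral). The relative outer space $\mathcal O$ is the set of equivalence classes of Grushko trees. A non-peripheral $g$ has an axis $T_g$ in each $T\in\mathcal O$; let $|g|_T$ be the number of edges of $T_g/\langle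 g\rangle$, and for $L>0$ let $\mathcal O_L(g)=\{T\in\mathcal O : |g|_T\le L\}$. * A *$\mathcal Z$-splitting* is a $(G,\mathcal A)$-tree with all edges of length one in which each edge stabilizer is trivial or cyclic and non-peripheral; it is a *free splitting* if all edge stabilizers are trivial. A non-peripheral $g$ is *simple* if it is elliptic in some free splitting. * The $\mathcal Z$-factor graph $\mathcal Z\mathrm F$ has as vertices the equivalence classes of $\mathcal Z$-splittings; two distinct vertices are joined by an edge if they are compatible or if some non-peripheral element is elliptic in both. The free factor graph $\mathrm{FF}$ has the same vertices; two distinct vertices are joined by an edge if they are compatible or if some *simple* element is elliptic in both. Both carry their path metrics. * $\pi$ assigns to a Grushko tree the $\mathcal Z$-splitting obtained by giving every edge length one. **Proposition.** For every real $L>0$ and every simple $g\in G$, the set $\pi(\mathcal O_L(g))$ (which may be empty) has diameter at most $2L+3$ in $\mathcal Z\mathrm F$, and it also has diameter at most $2L+3$ in $\mathrm{FF}$. -/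

import Mathlib

open scoped ENNReal

universe u

namespace GrushkoTrees

section Trees

variable {G : Type u} [Group G] {ι : Type*}

/-- A subgroup of `G` is peripheral if it is conjugate into one of the subgroups `A i`. -/
def IsPeripheralSubgroup (A : ι → Subgroup G) (H : Subgroup G) : Prop :=
  ∃ (i : ι) (a : G), ∀ h ∈ H, a * h * a⁻¹ ∈ A i

/-- An element of `G` is non-peripheral if it is nontrivial and not conjugate into any `A i`
(the identity counts as peripheral, also when there are no factors `A i`). -/
def NonPeripheral (A : ι → Subgroup G) (g : G) : Prop :=
  g ≠ 1 ∧ ∀ (i : ι) (a : G), a * g * a⁻¹ ∉ A i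

/-- A (nondegenerate) `(G, 𝒜)`-tree: a metric simplicial tree, given by its vertices, its edges and
the lengths of its edges, with a minimal cocompact isometric action of `G` without inversions, such
that each peripheral subgroup fixes a point, and such that at each vertex of degree two some element
of `G` fixes the vertex and interchanges the two incident edges.

Since `G` acts without inversions, an element (or a subgroup) that fixes a point of the tree fixes
a vertex. As the action is cocompact, all such trees have, up to isomorphism, their vertex
sets in the universe of `G`. -/
structure GATree (A : ι → Subgroup G) where
  V : Type u
  graph : SimpleGraph V
  isTree : graph.IsTree
  /-- the tree is not a single point -/
  nontrivial : Nontrivial V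
  [act : MulAction G V]
  adj_smul : ∀ (g : G) (v w : V), graph.Adj v w → graph.Adj (g • v) (g • w)
  no_inversion : ∀ (g : G) (v w : V), graph.Adj v w → ¬ (g • v = w ∧ g • w = v)
  /-- edge lengths; only the values on edges are meaningful -/
  len : Sym2 V → ℝ
  len_pos : ∀ v w : V, graph.Adj v w → 0 < len s(v, w)
  len_smul : ∀ (g : G) (v w : V), graph.Adj v w → len s(g • v, g • w) = len s(v, w)
  /-- the only invariant subtree is the whole tree -/
  minimal : ∀ S : Set V, (graph.induce S).Connected → (∀ (g : G), ∀ v ∈ S, g • v ∈ S) →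
    S = Set.univ
  /-- the translates of some finite subgraph cover all vertices and all edges -/
  cocompact : ∃ K : Set V, K.Finite ∧
    ∀ v w : V, (v = w ∨ graph.Adj v w) → ∃ g : G, g • v ∈ K ∧ g • w ∈ K
  peripheral_fix : ∀ i : ι, ∃ v : V, ∀ a ∈ A i, a • v = v
  degree_two : ∀ v x y : V, x ≠ y → graph.neighborSet v = {x, y} →
    ∃ g : G, g • v = v ∧ g • x = y ∧ g • y = x

attribute [instance] GATree.act

namespace GATree

variable {A : ι → Subgroup G}

/-- `g` fixes a point of `T`. -/
def Elliptic (T : GATree A) (g : G) : Prop := ∃ v : T.V, g • v = v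

/-- The stabilizer of the edge with endpoints `v` and `w` (there are no inversions). -/
def edgeStab (T : GATree A) (v w : T.V) : Subgroup G :=
  MulAction.stabilizer G v ⊓ MulAction.stabilizer G w

/-- `G`-equivariant isometry. An equivariant isometry between `(G, 𝒜)`-trees takes vertices to
vertices: those of degree other than two are metrically distinguished, and those of degree two are
by `degree_two` fixed points of elements that reverse a direction, which are vertices since there
are no inversions. -/
def Isometric (T T' : GATree A) : Prop :=
  ∃ f : T.graph ≃g T'.graph, (∀ (g : G) (v : T.V), f (g • v) = g • f v) ∧
    ∀ v w : T.V, T.graph.Adj v w → T'.len s(f v, f w) = T.len s(v, w)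

theorem Isometric.refl (T : GATree A) : T.Isometric T :=
  ⟨SimpleGraph.Iso.refl, fun _ _ => rfl, fun _ _ _ => rfl⟩

theorem Isometric.symm {T T' : GATree A} (h : T.Isometric T') : T'.Isometric T := by
  obtain ⟨f, hf, hl⟩ := h
  refine ⟨f.symm, fun g v => ?_, fun v w hvw => ?_⟩
  · apply f.injective
    rw [hf]
    simp
  · have := hl (f.symm v) (f.symm w) (f.symm.map_adj_iff.2 hvw)
    simpa using this.symm

theorem Isometric.trans {T T' T'' : GATree A} (h : T.Isometric T') (h' : T'.Isometric T'') :
    T.Isometric T'' := by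
  obtain ⟨f, hf, hl⟩ := h
  obtain ⟨f', hf', hl'⟩ := h'
  refine ⟨f.trans f', fun g v => ?_, fun v w hvw => ?_⟩
  · change f' (f (g • v)) = g • f' (f v)
    rw [hf, hf']
  · change T''.len s(f' (f v), f' (f w)) = _
    rw [hl' _ _ (f.map_adj_iff.2 hvw), hl _ _ hvw]

instance setoid (A : ι → Subgroup G) : Setoid (GATree A) where
  r := Isometric
  iseqv := ⟨Isometric.refl, Isometric.symm, Isometric.trans⟩

/-- A collapse `T → T'`: an equivariant simplicial map, each edge being mapped to an edge or to a
vertex, with nonempty connected point preimages. (The preimage of an interior point of an edge of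
`T'` is then automatically a single point, as `T` has no cycles.) -/
def Collapses (T T' : GATree A) : Prop :=
  ∃ f : T.V → T'.V, (∀ (g : G) (v : T.V), f (g • v) = g • f v) ∧
    (∀ v w : T.V, T.graph.Adj v w → f v = f w ∨ T'.graph.Adj (f v) (f w)) ∧
    ∀ x : T'.V, (T.graph.induce (f ⁻¹' {x})).Connected

/-- `T₀` and `T₁` have a common refinement. -/
def Compatible (T₀ T₁ : GATree A) : Prop :=
  ∃ T : GATree A, T.Collapses T₀ ∧ T.Collapses T₁

/-- Every elliptic element is peripheral and edge stabilizers are trivial. -/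
def IsGrushko (T : GATree A) : Prop :=
  (∀ g : G, T.Elliptic g → ¬ NonPeripheral A g) ∧
    ∀ v w : T.V, T.graph.Adj v w → T.edgeStab v w = ⊥

/-- Every edge has length one. -/
def UnitLength (T : GATree A) : Prop := ∀ v w : T.V, T.graph.Adj v w → T.len s(v, w) = 1

/-- Every edge has length one, and each edge stabilizer is trivial or cyclic and non-peripheral. -/
def IsZSplitting (T : GATree A) : Prop :=
  T.UnitLength ∧ ∀ v w : T.V, T.graph.Adj v w →
    T.edgeStab v w = ⊥ ∨ (IsCyclic (T.edgeStab v w) ∧ ¬ IsPeripheralSubgroup A (T.edgeStab v w))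

/-- A `𝒵`-splitting with trivial edge stabilizers. -/
def IsFreeSplitting (T : GATree A) : Prop :=
  T.IsZSplitting ∧ ∀ v w : T.V, T.graph.Adj v w → T.edgeStab v w = ⊥

/-- `γ` is a line in `T` (an injective bi-infinite edge path) that is invariant under `g`. -/
def IsInvariantLine (T : GATree A) (g : G) (γ : ℤ → T.V) : Prop :=
  Function.Injective γ ∧ (∀ n : ℤ, T.graph.Adj (γ n) (γ (n + 1))) ∧
    (fun v => g • v) '' Set.range γ = Set.range γ

/-- The edges of the axis `T_g`, the invariant line of `g`; this line is unique if `g` acts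
hyperbolically. -/
def axisEdges (T : GATree A) (g : G) : Set (Sym2 T.V) :=
  {e | ∃ γ : ℤ → T.V, T.IsInvariantLine g γ ∧ ∃ n : ℤ, e = s(γ n, γ (n + 1))}

/-- The orbit of an edge under the cyclic group generated by `g`. -/
def cyclicOrbit (T : GATree A) (g : G) (e : Sym2 T.V) : Set (Sym2 T.V) :=
  Set.range fun n : ℤ => e.map fun v => g ^ n • v

/-- The combinatorial length `|g|_T`: the number of edges of `T_g / ⟨g⟩`. -/
noncomputable def combLength (T : GATree A) (g : G) : ℕ∞ :=
  (T.cyclicOrbit g '' T.axisEdges g).encard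

/-- The tree `T` with all edge lengths replaced by one. -/
def rescale (T : GATree A) : GATree A :=
  { T with
    len := fun _ => 1
    len_pos := fun _ _ _ => one_pos
    len_smul := fun _ _ _ _ => rfl }

theorem IsGrushko.isZSplitting_rescale {T : GATree A} (h : T.IsGrushko) :
    T.rescale.IsZSplitting :=
  ⟨fun _ _ _ => rfl, fun v w hvw => Or.inl (h.2 v w hvw)⟩

end GATree

/-- A non-peripheral element is simple if it is elliptic in some free splitting. -/
def IsSimpleElt (A : ι → Subgroup G) (g : G) : Prop :=
  NonPeripheral A g ∧ ∃ T : GATree A, T.IsFreeSplitting ∧ T.Elliptic g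

/-- The relative outer space `𝒪(G, 𝒜)`: Grushko trees up to equivariant isometry. -/
def OuterSpace (A : ι → Subgroup G) : Type (u + 1) :=
  Quotient ((GATree.setoid A).comap (Subtype.val : {T : GATree A // T.IsGrushko} → GATree A))

/-- `𝒵`-splittings up to equivariant isometry. -/
def ZVertex (A : ι → Subgroup G) : Type (u + 1) :=
  Quotient ((GATree.setoid A).comap (Subtype.val : {T : GATree A // T.IsZSplitting} → GATree A))

/-- The class of a Grushko tree in `𝒪`. -/
def OuterSpace.mk {A : ι → Subgroup G} (T : GATree A) (hT : T.IsGrushko) : OuterSpace A :=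
  Quotient.mk _ ⟨T, hT⟩

/-- The class of a `𝒵`-splitting. -/
def ZVertex.mk {A : ι → Subgroup G} (T : GATree A) (hT : T.IsZSplitting) : ZVertex A :=
  Quotient.mk _ ⟨T, hT⟩

/-- The projection `π`, which gives each edge length one. -/
def proj (A : ι → Subgroup G) : OuterSpace A → ZVertex A :=
  Quotient.map (fun T => ⟨T.1.rescale, T.2.isZSplitting_rescale⟩) (by
    rintro T T' ⟨f, hf, -⟩
    exact ⟨f, hf, fun _ _ _ => rfl⟩)

/-- `𝒪_L(g)`: the classes of Grushko trees `T` with `|g|_T ≤ L`. -/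
def boundedLength (A : ι → Subgroup G) (L : ℝ) (g : G) : Set (OuterSpace A) :=
  {x | ∃ (T : GATree A) (hT : T.IsGrushko), OuterSpace.mk T hT = x ∧
    (T.combLength g : ℝ≥0∞) ≤ ENNReal.ofReal L}

/-- The graph on the classes of `𝒵`-splittings in which two distinct classes are adjacent if they
are compatible or if some element of `G` with the property `P` is elliptic in both. -/
def splittingGraph (A : ι → Subgroup G) (P : G → Prop) : SimpleGraph (ZVertex A) where
  Adj x y := x ≠ y ∧ ∃ (T₀ T₁ : GATree A) (h₀ : T₀.IsZSplitting) (h₁ : T₁.IsZSplitting),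
    ZVertex.mk T₀ h₀ = x ∧ ZVertex.mk T₁ h₁ = y ∧
      (T₀.Compatible T₁ ∨ ∃ g : G, P g ∧ T₀.Elliptic g ∧ T₁.Elliptic g)
  symm := ⟨by
    rintro x y ⟨hne, T₀, T₁, h₀, h₁, hx, hy, h⟩
    refine ⟨hne.symm, T₁, T₀, h₁, h₀, hy, hx, ?_⟩
    rcases h with ⟨T, hT⟩ | ⟨g, hg, hg'⟩
    · exact Or.inl ⟨T, hT.symm⟩
    · exact Or.inr ⟨g, hg, hg'.symm⟩⟩
  loopless := ⟨fun _ h => h.1 rfl⟩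

/-- The `𝒵`-factor graph. -/
def ZFactorGraph (A : ι → Subgroup G) : SimpleGraph (ZVertex A) :=
  splittingGraph A (NonPeripheral A)

/-- The free factor graph (in the model whose vertices are the `𝒵`-splittings). -/
def FreeFactorGraph (A : ι → Subgroup G) : SimpleGraph (ZVertex A) :=
  splittingGraph A (IsSimpleElt A)

end Trees

/-- The diameter of a set of vertices of a graph for the path metric of the graph; it is infinite
if two of the vertices are not joined by a path. -/
noncomputable def graphDiam {X : Type*} (Γ : SimpleGraph X) (S : Set X) : ℝ≥0∞ :=
  ⨆ x ∈ S, ⨆ y ∈ S, (Γ.edist x y : ℝ≥0∞)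

/-- The free product `A₁ * ⋯ * A_k * F_N`. -/
abbrev FreeProduct {k : ℕ} (A : Fin k → Type u) [∀ i, Group (A i)] (N : ℕ) : Type u :=
  Monoid.Coprod (Monoid.CoprodI A) (FreeGroup (Fin N))

/-- The factors `A i` as subgroups of the free product. -/
def factor {k : ℕ} (A : Fin k → Type u) [∀ i, Group (A i)] (N : ℕ) (i : Fin k) :
    Subgroup (FreeProduct A N) :=
  ((Monoid.Coprod.inl : Monoid.CoprodI A →* FreeProduct A N).comp
    (Monoid.CoprodI.of (i := i))).range

/-- The complexity `ξ(G, 𝒜) = 2k + 3N - 3`; the pair is non-sporadic if this is at least `3`. -/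
def complexity (k N : ℕ) : ℤ := 2 * k + 3 * N - 3

end GrushkoTrees

open GrushkoTrees

/-! A Grushko tree in which the simple element `g` has translation length ℓ is within ℓ + 1 of a
free splitting in which `g` is elliptic (`exists_elliptic_edist_rescale_le`), and two splittings in
which `g` is elliptic are at distance at most one. As ℓ is at most `|g|_T`, the triangle inequality
gives (ℓ + 1) + 1 + (ℓ' + 1) ≤ 2L + 3. All other moves are compatibilities, so the argument is the
same in both graphs.

The first move collapses every edge outside the orbit of one edge of the axis. Each later move is a
surgery on a free splitting T with one orbit of edges, which makes `g` strictly shorter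
(`exists_shorter_cutTree`). It runs as follows. Let `g` fix a vertex y of a free splitting S. Since
G acts simply transitively on the edges of T, an element x of G names an edge of T; colour it by the
side of a fixed edge of S on which x • y lies. As g • y = y, the elements x and x * g have the same
colour, so each translate h • γ of the axis γ inherits the colour of h. An edge is mixed if it lies
on translates of both colours. Mixed edges are finite in number. If there are any, an extremal
endpoint v meets just one of them, and the line whose colour is not that of this edge continues at v
along an unmixed edge of its own colour; if there are none, take any v at which both colours meet.

Now blow up v into an edge that separates the two colours. A fundamental segment of h • γ crosses
the new edge only by changing colour at v; this forces the single mixed edge at v to be its n-th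
edge with 0 < n < ℓ, and n determines h. So there are at most ℓ - 1 crossings.

Splittings are built from their half-spaces in G: a cut H with nested translates has a dual tree,
and two cuts that are nested with each other have a common dual tree refining both. The strict drop
in length also shows that the two cuts are not translates up to complement, and that the refinement
has no forbidden vertex of degree two. -/

namespace GrushkoTrees

/-! ### Half-spaces and directions in a simplicial tree -/

section TreeGeometry

variable {V : Type*} {Γ : SimpleGraph V}

/-- `u` lies on the side of `b` of the edge with endpoints `a` and `b`. -/
def Side (Γ : SimpleGraph V) (a b u : V) : Prop := Γ.dist b u < Γ.dist a u

open Classical in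
/-- The neighbour of `u` in the direction of `x`. -/
noncomputable def dir (Γ : SimpleGraph V) (u x : V) : V :=
  if h : ∃ w, Γ.Adj u w ∧ Side Γ u w x then h.choose else u

theorem side_right {a b : V} (h : Γ.Adj a b) : Side Γ a b b := by
  have := (SimpleGraph.dist_eq_one_iff_adj.2 h)
  simp [Side, this]

theorem not_side_left {a b : V} : ¬ Side Γ a b a := by
  simp [Side]

theorem not_side_iff (hT : Γ.IsTree) {a b u : V} (h : Γ.Adj a b) :
    ¬ Side Γ a b u ↔ Side Γ b a u := by
  have := hT.dist_ne_of_adj u h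
  rw [Γ.dist_comm (u := u), Γ.dist_comm (u := u) (v := b)] at this
  unfold Side
  omega

theorem Side.dist_eq (hT : Γ.IsTree) {a b u : V} (h : Γ.Adj a b) (hu : Side Γ a b u) :
    Γ.dist a u = Γ.dist b u + 1 := by
  have h1 : Γ.dist a u ≤ Γ.dist a b + Γ.dist b u := hT.1.dist_triangle
  rw [SimpleGraph.dist_eq_one_iff_adj.2 h] at h1
  unfold Side at hu
  omega

theorem exists_dir (hT : Γ.IsTree) {u x : V} (h : u ≠ x) : ∃ w, Γ.Adj u w ∧ Side Γ u w x := by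
  obtain ⟨p, hp⟩ := hT.1.exists_walk_length_eq_dist u x
  cases p with
  | nil => exact absurd rfl h
  | @cons _ w _ hw q =>
    refine ⟨w, hw, ?_⟩
    have := Γ.dist_le q
    simp only [SimpleGraph.Walk.length_cons] at hp
    unfold Side
    omega

/-- Each of the two neighbours starts a geodesic from `u` to `x`, and paths in a tree are unique. -/
theorem dir_unique (hT : Γ.IsTree) {u w w' x : V} (h : Γ.Adj u w) (hx : Side Γ u w x)
    (h' : Γ.Adj u w') (hx' : Side Γ u w' x) : w = w' := by
  obtain ⟨p, hp⟩ := hT.1.exists_walk_length_eq_dist w x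
  obtain ⟨p', hp'⟩ := hT.1.exists_walk_length_eq_dist w' x
  have e := hx.dist_eq hT h
  have e' := hx'.dist_eq hT h'
  have q := (SimpleGraph.Walk.cons h p).isPath_of_length_eq_dist (by simp [hp, e])
  have q' := (SimpleGraph.Walk.cons h' p').isPath_of_length_eq_dist (by simp [hp', e'])
  have := congrArg Subtype.val ((hT.2.subsingleton_path _ _).elim ⟨_, q⟩ ⟨_, q'⟩)
  simp only [SimpleGraph.Walk.cons.injEq] at this
  exact this.1

theorem dir_adj (hT : Γ.IsTree) {u x : V} (h : u ≠ x) : Γ.Adj u (dir Γ u x) := by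
  have := exists_dir hT h
  rw [dir, dif_pos this]
  exact this.choose_spec.1

theorem side_dir (hT : Γ.IsTree) {u x : V} (h : u ≠ x) : Side Γ u (dir Γ u x) x := by
  have := exists_dir hT h
  rw [dir, dif_pos this]
  exact this.choose_spec.2

theorem dir_eq (hT : Γ.IsTree) {u w x : V} (h : Γ.Adj u w) (hx : Side Γ u w x) :
    dir Γ u x = w := by
  have hne : u ≠ x := by
    rintro rfl
    exact not_side_left hx
  exact dir_unique hT (dir_adj hT hne) (side_dir hT hne) h hx

theorem dir_of_adj (hT : Γ.IsTree) {u w : V} (h : Γ.Adj u w) : dir Γ u w = w :=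
  dir_eq hT h (side_right h)

/-- Only one edge leads from one side of an edge to the other. -/
theorem eq_of_side_of_not_side (hT : Γ.IsTree) {a b p q : V} (hab : Γ.Adj a b) (hpq : Γ.Adj p q)
    (hp : Side Γ a b p) (hq : ¬ Side Γ a b q) : p = b ∧ q = a := by
  rw [not_side_iff hT hab] at hq
  have e1 := hp.dist_eq hT hab
  have e2 := hq.dist_eq hT hab.symm
  have one : Γ.dist p q = 1 := SimpleGraph.dist_eq_one_iff_adj.2 hpq
  have t1 : Γ.dist a p ≤ Γ.dist a q + Γ.dist q p := hT.1.dist_triangle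
  have t2 : Γ.dist b q ≤ Γ.dist b p + Γ.dist p q := hT.1.dist_triangle
  rw [Γ.dist_comm (u := q)] at t1
  have e3 : Γ.dist b p = Γ.dist a q := by omega
  by_cases hpb : p = b
  · subst hpb
    have : Γ.dist a q = 0 := by rw [← e3]; simp
    exact ⟨rfl, ((hT.1.dist_eq_zero_iff).1 this).symm⟩
  · exfalso
    have h1 := (dir_adj hT hpb)
    have h2 := (side_dir hT hpb)
    have h3 := h2.dist_eq hT h1
    have t3 : Γ.dist a (dir Γ p b) ≤ Γ.dist a b + Γ.dist b (dir Γ p b) := hT.1.dist_triangle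
    rw [SimpleGraph.dist_eq_one_iff_adj.2 hab] at t3
    rw [Γ.dist_comm (u := p), Γ.dist_comm (v := b)] at h3
    have h4 : Side Γ p (dir Γ p b) a := by
      unfold Side
      rw [Γ.dist_comm, Γ.dist_comm (u := p)]
      omega
    have h5 : Side Γ p q a := by
      unfold Side
      rw [Γ.dist_comm, Γ.dist_comm (u := p)]
      omega
    have h6 := dir_unique hT h1 h4 hpq h5
    rw [h6] at h3
    omega

theorem dir_congr_adj (hT : Γ.IsTree) {u p q : V} (hpq : Γ.Adj p q) (hp : u ≠ p) (hq : u ≠ q) :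
    dir Γ u p = dir Γ u q := by
  refine (dir_eq hT (dir_adj hT hp) ?_).symm
  by_contra h
  exact hq (eq_of_side_of_not_side hT (dir_adj hT hp) hpq (side_dir hT hp) h).2.symm

/-- A halfspace is connected: a property that is preserved under moving towards `b` inside of the
halfspace, and conversely, holds for a vertex of the halfspace if it holds for `b`. -/
theorem side_induction (hT : Γ.IsTree) {a b : V} (hab : Γ.Adj a b) {P : V → Prop} (hb : P b)
    (step : ∀ p q, Γ.Adj p q → Side Γ a b p → Side Γ a b q → P q → P p) {y : V}
    (hy : Side Γ a b y) : P y := by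
  induction hn : Γ.dist y b generalizing y with
  | zero =>
    rw [(hT.1.dist_eq_zero_iff).1 hn]
    exact hb
  | succ n ih =>
    have hne : y ≠ b := by
      rintro rfl
      simp at hn
    have h1 := dir_adj hT hne
    have h2 := (side_dir hT hne).dist_eq hT h1
    have h3 : Side Γ a b (dir Γ y b) := by
      by_contra h
      exact hne (eq_of_side_of_not_side hT hab h1 hy h).1
    exact step y _ h1 hy h3 (ih h3 (by omega))

theorem dir_eq_of_side (hT : Γ.IsTree) {a b u y : V} (hab : Γ.Adj a b) (hu : ¬ Side Γ a b u)
    (hy : Side Γ a b y) : dir Γ u y = dir Γ u b := by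
  refine side_induction hT hab (P := fun y => dir Γ u y = dir Γ u b) rfl ?_ hy
  intro p q hpq hp hq h
  rw [← h]
  apply dir_congr_adj hT hpq
  · rintro rfl; exact hu hp
  · rintro rfl; exact hu hq

/-- A half-space is connected, so an edge lying outside of it cannot separate two of its vertices.
-/
theorem side_iff_of_side (hT : Γ.IsTree) {a b a' b' y : V} (hab : Γ.Adj a b) (hab' : Γ.Adj a' b')
    (hy : Side Γ a b y) (ha' : ¬ Side Γ a b a') (hb' : ¬ Side Γ a b b') :
    Side Γ a' b' y ↔ Side Γ a' b' b := by
  refine side_induction hT hab (P := fun y => Side Γ a' b' y ↔ Side Γ a' b' b) Iff.rfl ?_ hy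
  intro p q hpq hp hq h
  rw [← h]
  constructor
  · intro h1
    by_contra h2
    obtain ⟨rfl, rfl⟩ := eq_of_side_of_not_side hT hab' hpq h1 h2
    exact hb' hp
  · intro h1
    by_contra h2
    obtain ⟨rfl, rfl⟩ := eq_of_side_of_not_side hT hab' hpq.symm h1 h2
    exact hb' hq

/-- Two predicates are nested if one of the four possible combinations of values does not occur. -/
def Nested {X : Type*} (C D : X → Prop) : Prop :=
  ∃ s t : Prop, ∀ x, ¬ ((C x ↔ s) ∧ (D x ↔ t))

theorem Nested.comp {X Y : Type*} {C D : X → Prop} (h : Nested C D) (f : Y → X) :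
    Nested (fun y => C (f y)) (fun y => D (f y)) := by
  obtain ⟨s, t, h⟩ := h
  exact ⟨s, t, fun y => h (f y)⟩

theorem Nested.symm {X : Type*} {C D : X → Prop} (h : Nested C D) : Nested D C := by
  obtain ⟨s, t, h⟩ := h
  exact ⟨t, s, fun y h' => h y h'.symm⟩

theorem side_iff_right_of_side (hT : Γ.IsTree) {a b a' b' : V} (hab : Γ.Adj a b)
    (hab' : Γ.Adj a' b') (hne : s(a, b) ≠ s(a', b')) : Side Γ a b a' ↔ Side Γ a b b' := by
  constructor
  · intro h
    by_contra h'
    obtain ⟨rfl, rfl⟩ := eq_of_side_of_not_side hT hab hab' h h'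
    exact hne Sym2.eq_swap
  · intro h
    by_contra h'
    obtain ⟨rfl, rfl⟩ := eq_of_side_of_not_side hT hab hab'.symm h h'
    exact hne rfl

theorem nested_side (hT : Γ.IsTree) {a b a' b' : V} (hab : Γ.Adj a b) (hab' : Γ.Adj a' b') :
    Nested (Side Γ a b) (Side Γ a' b') := by
  by_cases hne : s(a, b) = s(a', b')
  · rcases Sym2.eq_iff.1 hne with ⟨rfl, rfl⟩ | ⟨rfl, rfl⟩
    · exact ⟨True, False, by tauto⟩
    · refine ⟨True, True, fun x hx => ?_⟩
      have := not_side_iff hT (u := x) hab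
      tauto
  · have h1 := side_iff_right_of_side hT hab hab' hne
    have h2 := side_iff_right_of_side hT hab' hab (Ne.symm hne)
    -- For different edges, the half-space of each that does not contain the other edge is taken;
    -- these two are disjoint.
    refine ⟨¬ Side Γ a b a', ¬ Side Γ a' b' a, fun y hy => ?_⟩
    by_cases hy1 : Side Γ a b y
    · have := side_iff_of_side hT hab hab' hy1 (by tauto) (by tauto)
      tauto
    · have h3 := not_side_iff hT (u := y) hab
      have h4 := not_side_iff hT (u := a') hab
      have h5 := not_side_iff hT (u := b') hab
      have := side_iff_of_side hT hab.symm hab' (y := y) (by tauto) (by tauto) (by tauto)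
      tauto

end TreeGeometry

/-! ### The tree dual to a nested family of walls -/

section WallSpaces

/-- A set `X` with a nested family of bipartitions (walls), any two points being separated by
finitely many walls; `pt x` is the set of walls that have `x` on their positive side. -/
structure WallSpace (W X : Type*) where
  pt : X → Set W
  nested : ∀ p q, p ≠ q → Nested (fun x => p ∈ pt x) (fun x => q ∈ pt x)
  finite_sep : ∀ x y, {p | ¬ (p ∈ pt x ↔ p ∈ pt y)}.Finite
  exists_ne : ∀ p q, p ≠ q → ∃ x, ¬ (p ∈ pt x ↔ q ∈ pt x)
  exists_eq : ∀ p q, p ≠ q → ∃ x, (p ∈ pt x ↔ q ∈ pt x)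

namespace WallSpace

variable {W X : Type*} (S : WallSpace W X)

/-- A vertex of the dual tree: a choice of a side of each wall such that any two of the sides
meet, and which differs from the choice made by a point for finitely many walls. -/
def IsVertex (ω : Set W) : Prop :=
  (∀ p q, ∃ x, (p ∈ ω ↔ p ∈ S.pt x) ∧ (q ∈ ω ↔ q ∈ S.pt x)) ∧
    ∀ x, {p | ¬ (p ∈ ω ↔ p ∈ S.pt x)}.Finite

/-- The vertices of the dual tree. -/
abbrev Vertex : Type _ := {ω : Set W // S.IsVertex ω}

/-- Two choices of sides differ at the wall `p` and at no other wall. -/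
def DiffersAt (p : W) (ω ω' : Set W) : Prop := ∀ q, (q ∈ ω ↔ q ∈ ω') ↔ q ≠ p

variable {S}

theorem DiffersAt.symm {p : W} {ω ω' : Set W} (h : DiffersAt p ω ω') : DiffersAt p ω' ω :=
  fun q => by rw [← h q]; exact iff_comm

theorem DiffersAt.iff_of_ne {p q : W} {ω ω' : Set W} (h : DiffersAt p ω ω') (hq : q ≠ p) :
    q ∈ ω ↔ q ∈ ω' := (h q).2 hq

theorem DiffersAt.not_iff {p : W} {ω ω' : Set W} (h : DiffersAt p ω ω') :
    ¬ (p ∈ ω ↔ p ∈ ω') := fun h' => (h p).1 h' rfl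

theorem DiffersAt.ne {p : W} {ω ω' : Set W} (h : DiffersAt p ω ω') : ω ≠ ω' := by
  rintro rfl
  exact h.not_iff Iff.rfl

theorem DiffersAt.wall_unique {p q : W} {ω ω' : Set W} (h : DiffersAt p ω ω')
    (h' : DiffersAt q ω ω') : p = q := by
  by_contra hne
  exact h.not_iff ((h' p).2 hne)

theorem DiffersAt.eq_of_left {p : W} {ω ω₁ ω₂ : Set W} (h : DiffersAt p ω ω₁)
    (h' : DiffersAt p ω ω₂) : ω₁ = ω₂ := by
  ext q
  have h1 := h q
  have h2 := h' q
  tauto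

variable (S)

/-- The dual tree of a wall space. -/
def graph : SimpleGraph S.Vertex where
  Adj ω ω' := ∃ p, DiffersAt p ω.1 ω'.1
  symm := ⟨fun _ _ ⟨p, h⟩ => ⟨p, h.symm⟩⟩
  loopless := ⟨fun _ ⟨_, h⟩ => h.ne rfl⟩

/-- The vertex given by a point. -/
def point (x : X) : S.Vertex :=
  ⟨S.pt x, fun _ _ => ⟨x, Iff.rfl, Iff.rfl⟩, fun y => S.finite_sep x y⟩

variable {S}

theorem IsVertex.finite_diff [Nonempty X] {ω ω' : Set W} (h : S.IsVertex ω)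
    (h' : S.IsVertex ω') : {p | ¬ (p ∈ ω ↔ p ∈ ω')}.Finite := by
  obtain ⟨x⟩ := ‹Nonempty X›
  refine ((h.2 x).union (h'.2 x)).subset fun p hp => ?_
  simp only [Set.mem_ofPred_eq, Set.mem_union] at hp ⊢
  tauto

/-- Any vertex can be moved towards a different one across one wall. -/
theorem exists_flip [Nonempty X] {ω ω' : S.Vertex} (hne : ω ≠ ω') :
    ∃ (p : W) (ω₁ : S.Vertex), DiffersAt p ω.1 ω₁.1 ∧ ¬ (p ∈ ω.1 ↔ p ∈ ω'.1) := by
  have hfin := ω.2.finite_diff ω'.2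
  have hD : {p | ¬ (p ∈ ω.1 ↔ p ∈ ω'.1)}.Nonempty := by
    by_contra h
    rw [Set.not_nonempty_iff_eq_empty] at h
    apply hne
    apply Subtype.ext
    ext p
    by_contra hp
    exact (h ▸ hp : p ∈ (∅ : Set W))
  -- Among the walls separating `ω` from `ω'`, take one whose side chosen by `ω` is minimal for
  -- inclusion.
  obtain ⟨p, hp, hmin⟩ := hfin.exists_minimalFor
    (fun p => {x | p ∈ ω.1 ↔ p ∈ S.pt x}) _ hD
  -- This is what allows `p` to be flipped. Otherwise the side of `q` is contained in that of `p`: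
  -- if `q` separates, minimality makes the sides equal, which is impossible for different walls; if
  -- not, `ω'` would choose two disjoint sides.
  have key : ∀ q, q ≠ p → ∃ x, (q ∈ ω.1 ↔ q ∈ S.pt x) ∧ ¬ (p ∈ ω.1 ↔ p ∈ S.pt x) := by
    intro q hq
    by_contra hcon
    push Not at hcon
    by_cases hqD : q ∈ {p | ¬ (p ∈ ω.1 ↔ p ∈ ω'.1)}
    · have h1 := hmin hqD (fun x hx => hcon x hx)
      have h2 : ∀ x, (q ∈ ω.1 ↔ q ∈ S.pt x) ↔ (p ∈ ω.1 ↔ p ∈ S.pt x) :=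
        fun x => ⟨hcon x, fun hx => h1 hx⟩
      obtain ⟨x, hx⟩ := S.exists_ne q p hq
      obtain ⟨y, hy⟩ := S.exists_eq q p hq
      have hx' := h2 x
      have hy' := h2 y
      tauto
    · obtain ⟨x, hx1, hx2⟩ := ω'.2.1 p q
      have := hcon x
      simp only [Set.mem_ofPred_eq, not_not] at hqD hp
      tauto
  classical
  refine ⟨p, ⟨{q | if q = p then p ∉ ω.1 else q ∈ ω.1}, ?_, ?_⟩, ?_, hp⟩
  · intro q r
    by_cases hq : q = p <;> by_cases hr : r = p
    · subst hq hr
      obtain ⟨x, hx⟩ := ω'.2.1 r r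
      refine ⟨x, ?_⟩
      simp only [Set.mem_ofPred_eq] at hp ⊢
      simp only [if_true]
      tauto
    · subst hq
      obtain ⟨x, hx⟩ := key r hr
      refine ⟨x, ?_⟩
      simp only [Set.mem_ofPred_eq, if_true, if_neg hr]
      tauto
    · subst hr
      obtain ⟨x, hx⟩ := key q hq
      refine ⟨x, ?_⟩
      simp only [Set.mem_ofPred_eq, if_true, if_neg hq]
      tauto
    · simp only [Set.mem_ofPred_eq, if_neg hq, if_neg hr]
      exact ω.2.1 q r
  · intro x
    refine ((ω.2.2 x).union (Set.finite_singleton p)).subset fun q hq => ?_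
    by_cases hqp : q = p
    · exact Or.inr hqp
    · simp only [Set.mem_ofPred_eq, if_neg hqp] at hq
      exact Or.inl hq
  · intro q
    by_cases hqp : q = p
    · subst hqp
      simp
    · simp [hqp]

/-- The edge of the dual tree that crosses a given wall is unique. -/
theorem eq_of_differsAt {p : W} {ω ω₁ α α₁ : S.Vertex} (h : DiffersAt p ω.1 ω₁.1)
    (h' : DiffersAt p α.1 α₁.1) (hp : p ∈ ω.1 ↔ p ∈ α.1) : ω = α := by
  apply Subtype.ext
  ext q
  by_cases hq : q = p
  · rw [hq, hp]
  · by_contra hne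
    -- If the two edges across `p` disagreed at `q`, their four endpoints would occupy all four
    -- corners of `p` and `q`.
    obtain ⟨s, t, hst⟩ := S.nested p q (Ne.symm hq)
    have h1 := h.not_iff
    have h2 := h'.not_iff
    have h3 := h.iff_of_ne hq
    have h4 := h'.iff_of_ne hq
    obtain ⟨x1, hx1⟩ := ω.2.1 p q
    obtain ⟨x2, hx2⟩ := ω₁.2.1 p q
    obtain ⟨x3, hx3⟩ := α.2.1 p q
    obtain ⟨x4, hx4⟩ := α₁.2.1 p q
    have k1 := hst x1
    have k2 := hst x2
    have k3 := hst x3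
    have k4 := hst x4
    simp only [← hx1.1, ← hx1.2, ← hx2.1, ← hx2.2, ← hx3.1, ← hx3.2, ← hx4.1, ← hx4.2] at k1 k2 k3 k4
    clear hst hx1 hx2 hx3 hx4
    grind

theorem eq_of_differsAt_right {p : W} {ω ω₁ α α₁ : S.Vertex} (h : DiffersAt p ω.1 ω₁.1)
    (h' : DiffersAt p α.1 α₁.1) (hp : p ∈ ω.1 ↔ p ∈ α.1) : ω₁ = α₁ := by
  have h1 := h.not_iff
  have h2 := h'.not_iff
  exact eq_of_differsAt h.symm h'.symm (by tauto)

theorem DiffersAt.ncard_add_one {p : W} {ω ω₁ ω' : S.Vertex} [Nonempty X]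
    (h : DiffersAt p ω.1 ω₁.1) (hp : ¬ (p ∈ ω.1 ↔ p ∈ ω'.1)) :
    {q | ¬ (q ∈ ω₁.1 ↔ q ∈ ω'.1)}.ncard + 1 = {q | ¬ (q ∈ ω.1 ↔ q ∈ ω'.1)}.ncard := by
  have heq : {q | ¬ (q ∈ ω₁.1 ↔ q ∈ ω'.1)} = {q | ¬ (q ∈ ω.1 ↔ q ∈ ω'.1)} \ {p} := by
    ext q
    have := h q
    by_cases hq : q = p
    · subst hq
      simp only [Set.mem_ofPred_eq, Set.mem_sdiff, Set.mem_singleton_iff]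
      tauto
    · simp only [Set.mem_ofPred_eq, Set.mem_sdiff, Set.mem_singleton_iff]
      tauto
  have hpos : 0 < {q | ¬ (q ∈ ω.1 ↔ q ∈ ω'.1)}.ncard :=
    (Set.ncard_pos (ω.2.finite_diff ω'.2)).2 ⟨p, hp⟩
  rw [heq, Set.ncard_sdiff_singleton_of_mem hp]
  omega

/-- Two vertices are joined by a path that crosses only walls separating them, each one once. -/
theorem exists_walk [Nonempty X] (ω ω' : S.Vertex) :
    ∃ w : S.graph.Walk ω ω', w.length ≤ {p | ¬ (p ∈ ω.1 ↔ p ∈ ω'.1)}.ncard ∧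
      ∀ α ∈ w.support, ∀ q, (q ∈ ω.1 ↔ q ∈ ω'.1) → (q ∈ α.1 ↔ q ∈ ω.1) := by
  induction hn : {p | ¬ (p ∈ ω.1 ↔ p ∈ ω'.1)}.ncard generalizing ω with
  | zero =>
    have : ω = ω' := by
      by_contra hne
      obtain ⟨p, _, _, hp⟩ := exists_flip hne
      rw [Set.ncard_eq_zero (ω.2.finite_diff ω'.2)] at hn
      exact (hn ▸ hp : p ∈ (∅ : Set W))
    subst this
    refine ⟨.nil, by simp, ?_⟩
    simp
  | succ n ih =>
    have hne : ω ≠ ω' := by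
      rintro rfl
      simp at hn
    obtain ⟨p, ω₁, h1, hp⟩ := exists_flip hne
    have hcard : {q | ¬ (q ∈ ω₁.1 ↔ q ∈ ω'.1)}.ncard = n := by
      have := h1.ncard_add_one hp
      omega
    obtain ⟨w, hw, hs⟩ := ih ω₁ hcard
    have hadj : S.graph.Adj ω ω₁ := ⟨p, h1⟩
    refine ⟨.cons hadj w, by simpa using hw, ?_⟩
    intro α hα q hq
    rw [SimpleGraph.Walk.support_cons, List.mem_cons] at hα
    rcases hα with rfl | hα
    · exact Iff.rfl
    · have hqp : q ≠ p := by
        rintro rfl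
        exact hp hq
      have := h1.iff_of_ne hqp
      rw [this]
      exact hs α hα q (by rw [← this]; exact hq)

theorem dist_le [Nonempty X] (ω ω' : S.Vertex) :
    S.graph.dist ω ω' ≤ {p | ¬ (p ∈ ω.1 ↔ p ∈ ω'.1)}.ncard := by
  obtain ⟨w, hw, -⟩ := exists_walk ω ω'
  exact (S.graph.dist_le w).trans hw

theorem mem_edges_of_walk {p : W} {ω ω₁ α β : S.Vertex} (h : DiffersAt p ω.1 ω₁.1)
    (w : S.graph.Walk α β) (hα : p ∈ α.1 ↔ p ∈ ω.1) (hβ : ¬ (p ∈ β.1 ↔ p ∈ ω.1)) :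
    s(ω, ω₁) ∈ w.edges := by
  induction w with
  | nil => exact absurd hα hβ
  | @cons a b c hab w ih =>
    rw [SimpleGraph.Walk.edges_cons, List.mem_cons]
    by_cases hb : p ∈ b.1 ↔ p ∈ ω.1
    · exact Or.inr (ih hb hβ)
    · left
      obtain ⟨q, hq⟩ := hab
      have : q = p := by
        by_contra hne
        have := hq.iff_of_ne (Ne.symm hne)
        tauto
      subst this
      rw [eq_of_differsAt h hq hα.symm, eq_of_differsAt_right h hq hα.symm]

/-- Every edge is a bridge: a walk between its endpoints has to cross its wall, and only this one
edge crosses that wall. -/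
theorem isTree [Nonempty X] : S.graph.IsTree := by
  have : Nonempty S.Vertex := ‹Nonempty X›.map S.point
  refine ⟨⟨fun ω ω' => ?_⟩, ?_⟩
  · obtain ⟨w, -⟩ := exists_walk ω ω'
    exact w.reachable
  · rw [SimpleGraph.isAcyclic_iff_forall_adj_isBridge]
    rintro ω ω₁ ⟨p, h⟩
    rw [SimpleGraph.isBridge_iff_forall_walk_mem_edges]
    intro w
    exact mem_edges_of_walk h w Iff.rfl (fun h' => h.not_iff h'.symm)

end WallSpace

end WallSpaces

/-! ### Cuts of a group and their dual splittings -/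

section Cuts

variable {G : Type u} [Group G] {ι : Type*}

/-- The standing assumptions: `G` is torsion-free and not commutative, and the peripheral factors
are infinite. -/
structure Ambient (A : ι → Subgroup G) : Prop where
  torsionFree : ∀ k : G, k ≠ 1 → ¬ IsOfFinOrder k
  infinite : ∀ i, Infinite (A i)
  noncomm : ∃ x y : G, x * y ≠ y * x

/-- Two points of `G` are separated by finitely many translates of `H`. -/
def FiniteSep (H : Set G) : Prop := ∀ x y : G, {h | ¬ (h * x ∈ H ↔ h * y ∈ H)}.Finite

/-- The peripheral factors are elliptic with respect to `H`: each translate of `H` contains almost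
all or almost none of `A i`, and for almost all translates this is decided by the element `1`. -/
def PeripherallyElliptic (A : ι → Subgroup G) (H : Set G) : Prop :=
  ∀ i, ∃ L : Set G, (∀ h, {a : A i | ¬ (h * (a : G) ∈ H ↔ h ∈ L)}.Finite) ∧
    {h | ¬ (h ∈ H ↔ h ∈ L)}.Finite

/-- A subset of `G` that determines a one-edge splitting of `G` with trivial edge group. -/
structure IsCut (A : ι → Subgroup G) (H : Set G) : Prop where
  finiteSep : FiniteSep H
  peripherallyElliptic : PeripherallyElliptic A H
  nested : ∀ k : G, Nested (fun x => x ∈ H) (fun x => k * x ∈ H)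
  -- One element would not be enough: for infinite `G` the tree dual to `H = {1}` is a star with
  -- fixed centre, so it is not minimal.
  large : ∃ x y, x ≠ y ∧ x ∈ H ∧ y ∈ H
  large_compl : ∃ x y, x ≠ y ∧ x ∉ H ∧ y ∉ H

variable {A : ι → Subgroup G}

theorem pow_injective_of_ne_one (hA : Ambient A) {k : G} (hk : k ≠ 1) :
    Function.Injective fun n : ℕ => k ^ n :=
  injective_pow_iff_not_isOfFinOrder.2 (hA.torsionFree k hk)

/-- Otherwise the infinitely many powers of `k` would all give translates of `H` separating `x` from
`y`. Hence different translates of a cut are different walls. -/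
theorem FiniteSep.eq_one (hA : Ambient A) {H : Set G} (hH : FiniteSep H) {x y : G} (hx : x ∈ H)
    (hy : y ∉ H) {k : G} (hk : ∀ z, z ∈ H ↔ k * z ∈ H) : k = 1 := by
  by_contra hne
  have hpow : ∀ (n : ℕ) z, z ∈ H ↔ k ^ n * z ∈ H := by
    intro n
    induction n with
    | zero => simp
    | succ n ih =>
      intro z
      rw [ih z, hk, pow_succ', mul_assoc]
  refine (Set.infinite_range_of_injective (pow_injective_of_ne_one hA hne)) ((hH x y).subset ?_)
  rintro _ ⟨n, rfl⟩
  have h1 := hpow n x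
  have h2 := hpow n y
  simp only [Set.mem_ofPred_eq]
  tauto

/-- A family of pairwise nested cuts, no two of which have a common translate up to complement. -/
structure CutFamily (A : ι → Subgroup G) (J : Type) where
  ambient : Ambient A
  H : J → Set G
  cut : ∀ j, IsCut A (H j)
  nested : ∀ j j', j ≠ j' → ∀ k, Nested (fun x => x ∈ H j) (fun x => k * x ∈ H j')
  exists_ne : ∀ j j', j ≠ j' → ∀ k, ∃ x, ¬ (x ∈ H j ↔ k * x ∈ H j')
  exists_eq : ∀ j j', j ≠ j' → ∀ k, ∃ x, (x ∈ H j ↔ k * x ∈ H j')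

theorem iff_of_not_iff {p q c : Prop} (hp : ¬ (p ↔ c)) (hq : ¬ (q ↔ c)) : p ↔ q := by
  tauto

theorem finite_of_slices {J : Type*} {X : Type*} [Finite J] {s : Set (J × X)}
    (h : ∀ j, {x | (j, x) ∈ s}.Finite) : s.Finite := by
  refine (Set.finite_iUnion fun j => (h j).image (Prod.mk j)).subset ?_
  rintro ⟨j, x⟩ hx
  exact Set.mem_iUnion.2 ⟨j, x, hx, rfl⟩

namespace CutFamily

variable {J : Type}

/-- The action of `G` on the choices of sides. -/
def translate (k : G) (ω : Set (J × G)) : Set (J × G) := {p | (p.1, p.2 * k) ∈ ω}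

theorem mem_translate {k : G} {ω : Set (J × G)} {p : J × G} :
    p ∈ translate k ω ↔ (p.1, p.2 * k) ∈ ω := Iff.rfl

variable [Finite J]

/-- The wall space with points `G` whose walls are the translates of the cuts. -/
def wallSpace (C : CutFamily A J) : WallSpace (J × G) G where
  pt x := {p | p.2 * x ∈ C.H p.1}
  nested := by
    rintro ⟨j, h⟩ ⟨j', h'⟩ -
    have key : Nested (fun x => x ∈ C.H j) (fun x => h' * h⁻¹ * x ∈ C.H j') := by
      by_cases hj : j = j'
      · subst hj
        exact (C.cut j).nested _
      · exact C.nested j j' hj _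
    have := key.comp (fun x => h * x)
    simp only [mul_assoc, inv_mul_cancel_left] at this
    exact this
  finite_sep x y := finite_of_slices fun j => (C.cut j).finiteSep x y
  exists_ne := by
    rintro ⟨j, h⟩ ⟨j', h'⟩ hne
    by_contra hcon
    push Not at hcon
    have hk : ∀ z, z ∈ C.H j ↔ h' * h⁻¹ * z ∈ C.H j' := by
      intro z
      have := hcon (h⁻¹ * z)
      simpa [mul_assoc] using this
    by_cases hj : j = j'
    · subst hj
      obtain ⟨x, -, -, hx, -⟩ := (C.cut j).large
      obtain ⟨y, -, -, hy, -⟩ := (C.cut j).large_compl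
      have := (C.cut j).finiteSep.eq_one C.ambient hx hy hk
      apply hne
      rw [mul_inv_eq_one] at this
      rw [this]
    · obtain ⟨x, hx⟩ := C.exists_ne j j' hj (h' * h⁻¹)
      exact hx (hk x)
  exists_eq := by
    rintro ⟨j, h⟩ ⟨j', h'⟩ hne
    by_contra hcon
    push Not at hcon
    have hk : ∀ z, ¬ (z ∈ C.H j ↔ h' * h⁻¹ * z ∈ C.H j') := by
      intro z
      have := hcon (h⁻¹ * z)
      simp only [Set.mem_ofPred_eq, mul_inv_cancel_left] at this
      simp only [mul_assoc]
      tauto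
    by_cases hj : j = j'
    · subst hj
      obtain ⟨x, -, -, hx, -⟩ := (C.cut j).large
      obtain ⟨y, -, -, hy, -⟩ := (C.cut j).large_compl
      -- An element that takes a cut to its complement has a square preserving the cut, so it has
      -- order at most two; torsion-freeness makes it trivial.
      have := (C.cut j).finiteSep.eq_one C.ambient hx hy (k := (h' * h⁻¹) ^ 2) (fun z => by
        have h1 := hk z
        have h2 := hk (h' * h⁻¹ * z)
        rw [pow_two, mul_assoc]
        tauto)
      by_cases h1 : h' * h⁻¹ = 1
      · have := hk x
        rw [h1] at this
        simp at this
      · exact C.ambient.torsionFree _ h1 (isOfFinOrder_iff_pow_eq_one.2 ⟨2, by norm_num, this⟩)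
    · obtain ⟨x, hx⟩ := C.exists_eq j j' hj (h' * h⁻¹)
      exact hk x hx

open WallSpace

variable (C : CutFamily A J)

theorem mem_pt {x : G} {p : J × G} : p ∈ C.wallSpace.pt x ↔ p.2 * x ∈ C.H p.1 := Iff.rfl

theorem isVertex_translate (k : G) {ω : Set (J × G)} (hω : C.wallSpace.IsVertex ω) :
    C.wallSpace.IsVertex (translate k ω) := by
  refine ⟨fun p q => ?_, fun x => ?_⟩
  · obtain ⟨x, h1, h2⟩ := hω.1 (p.1, p.2 * k) (q.1, q.2 * k)
    refine ⟨k * x, ?_, ?_⟩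
    · rw [mem_translate, h1, mem_pt, mem_pt, mul_assoc]
    · rw [mem_translate, h2, mem_pt, mem_pt, mul_assoc]
  · have hinj : Function.Injective (fun p : J × G => (p.1, p.2 * k)) := by
      rintro ⟨j, h⟩ ⟨j', h'⟩ hp
      simpa using hp
    refine ((hω.2 (k⁻¹ * x)).preimage hinj.injOn).subset fun p hp => ?_
    simp only [Set.mem_preimage, Set.mem_ofPred_eq, mem_translate, mem_pt] at hp ⊢
    simpa [mul_assoc] using hp

instance : MulAction G C.wallSpace.Vertex where
  smul k ω := ⟨translate k ω.1, C.isVertex_translate k ω.2⟩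
  one_smul ω := by
    apply Subtype.ext
    change translate 1 ω.1 = ω.1
    ext p
    simp [mem_translate]
  mul_smul k k' ω := by
    apply Subtype.ext
    change translate (k * k') ω.1 = translate k (translate k' ω.1)
    ext p
    simp [mem_translate, mul_assoc]

variable {C}

theorem mem_smul {k : G} {ω : C.wallSpace.Vertex} {p : J × G} :
    p ∈ (k • ω).1 ↔ (p.1, p.2 * k) ∈ ω.1 := Iff.rfl

theorem smul_point (k x : G) : k • C.wallSpace.point x = C.wallSpace.point (k * x) := by
  apply Subtype.ext
  ext p
  rw [mem_smul]
  change p.2 * k * x ∈ C.H p.1 ↔ p.2 * (k * x) ∈ C.H p.1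
  rw [mul_assoc]

theorem differsAt_smul {p : J × G} {ω ω' : C.wallSpace.Vertex} (h : DiffersAt p ω.1 ω'.1) (k : G) :
    DiffersAt (p.1, p.2 * k⁻¹) (k • ω).1 (k • ω').1 := by
  intro q
  rw [mem_smul, mem_smul, h]
  apply not_congr
  constructor
  · rintro rfl
    simp
  · rintro rfl
    simp

theorem adj_smul {ω ω' : C.wallSpace.Vertex} (h : C.wallSpace.graph.Adj ω ω') (k : G) :
    C.wallSpace.graph.Adj (k • ω) (k • ω') := by
  obtain ⟨p, h⟩ := h
  exact ⟨_, differsAt_smul h k⟩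

/-- An edge determines its wall, and `G` acts freely on the walls. This excludes inversions as well
as edge stabilizers. -/
theorem eq_one_of_smul_edge {ω ω' : C.wallSpace.Vertex} (h : C.wallSpace.graph.Adj ω ω') {k : G}
    (h1 : s(k • ω, k • ω') = s(ω, ω')) : k = 1 := by
  obtain ⟨⟨j, h0⟩, h⟩ := h
  have h2 := differsAt_smul h k
  have h3 : DiffersAt (j, h0 * k⁻¹) ω.1 ω'.1 := by
    rcases Sym2.eq_iff.1 h1 with ⟨e1, e2⟩ | ⟨e1, e2⟩
    · rwa [e1, e2] at h2
    · rw [e1, e2] at h2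
      exact h2.symm
  have h4 := h.wall_unique h3
  simpa using h4

/-- An invariant set of vertices lies on both sides of each wall. -/
theorem exists_mem_side {S : Set C.wallSpace.Vertex} (hne : S.Nonempty)
    (hS : ∀ k : G, ∀ v ∈ S, k • v ∈ S) (p : J × G) (c : Prop) : ∃ s ∈ S, ¬ (p ∈ s.1 ↔ c) := by
  obtain ⟨j, h0⟩ := p
  by_contra hcon
  push Not at hcon
  obtain ⟨s, hs⟩ := hne
  have hall : ∀ h, (j, h) ∈ s.1 ↔ c := by
    intro h
    have := hcon _ (hS (h0⁻¹ * h) s hs)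
    rwa [mem_smul, mul_inv_cancel_left] at this
  -- Two points of the side W of the cut that the orbit of `s` avoids.
  obtain ⟨x, y, hxy, hx, hy⟩ : ∃ x y, x ≠ y ∧ ¬ (x ∈ C.H j ↔ c) ∧ ¬ (y ∈ C.H j ↔ c) := by
    by_cases hc : c
    · obtain ⟨x, y, h1, h2, h3⟩ := (C.cut j).large_compl
      exact ⟨x, y, h1, by tauto, by tauto⟩
    · obtain ⟨x, y, h1, h2, h3⟩ := (C.cut j).large
      exact ⟨x, y, h1, by tauto, by tauto⟩
  -- No nontrivial `k` maps W into itself: all `k ^ n * x` would lie in W, and infinitely many walls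
  -- would separate `s` from `x`.
  have main : ∀ k : G, k ≠ 1 → ¬ ∀ z, ¬ (z ∈ C.H j ↔ c) → ¬ (k * z ∈ C.H j ↔ c) := by
    intro k hk hkW
    have hpow : ∀ n : ℕ, ¬ (k ^ n * x ∈ C.H j ↔ c) := by
      intro n
      induction n with
      | zero => simpa using hx
      | succ n ih =>
        rw [pow_succ', mul_assoc]
        exact hkW _ ih
    have hinj : Function.Injective fun n : ℕ => ((j, k ^ n) : J × G) :=
      fun m n hmn => pow_injective_of_ne_one C.ambient hk (congrArg Prod.snd hmn)
    refine (Set.infinite_range_of_injective hinj) ((s.2.2 x).subset ?_)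
    rintro _ ⟨n, rfl⟩
    have h1 := hpow n
    have h2 := hall (k ^ n)
    simp only [Set.mem_ofPred_eq, mem_pt]
    tauto
  have hk : y * x⁻¹ ≠ 1 := by
    rw [Ne, mul_inv_eq_one]
    exact Ne.symm hxy
  -- For k = `y * x⁻¹`, the corner of points with neither z nor k * z in W is occupied because `s`
  -- is a vertex, and the corner with both in W is occupied by `x`. So the empty corner is a mixed
  -- one, and k or its inverse maps W into itself.
  obtain ⟨a, b, hab⟩ := (C.cut j).nested (y * x⁻¹)
  obtain ⟨z, hz1, hz2⟩ := s.2.1 (j, 1) (j, y * x⁻¹)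
  simp only [hall, mem_pt, one_mul] at hz1 hz2
  have hyx : y * x⁻¹ * x = y := by simp
  dsimp only at hab
  have hz := hab z
  have hx' := hab x
  rw [hyx] at hx'
  rw [← hz1, ← hz2] at hz
  by_cases hac : a ↔ c
  · have hbc : ¬ (b ↔ c) := fun h => hz ⟨hac.symm, h.symm⟩
    refine main _ (inv_ne_one.2 hk) fun z' hz' h => ?_
    have := hab ((y * x⁻¹)⁻¹ * z')
    rw [mul_inv_cancel_left] at this
    exact this ⟨h.trans hac.symm, iff_of_not_iff hz' hbc⟩
  · have hbc : b ↔ c := by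
      by_contra h
      exact hx' ⟨iff_of_not_iff hx hac, iff_of_not_iff hy h⟩
    refine main _ hk fun z' hz' h => ?_
    exact hab z' ⟨iff_of_not_iff hz' hac, h.trans hbc.symm⟩

/-- Step from a vertex of `S` towards `ω`. The wall to be crossed has vertices of `S` on both sides,
and a path in `S` joining them must use the only edge that crosses it; so the step stays in `S`. -/
theorem eq_univ_of_invariant {S : Set C.wallSpace.Vertex}
    (hconn : (C.wallSpace.graph.induce S).Connected) (hS : ∀ k : G, ∀ v ∈ S, k • v ∈ S) :
    S = Set.univ := by
  have hne : S.Nonempty := by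
    obtain ⟨⟨s, hs⟩⟩ := hconn.nonempty
    exact ⟨s, hs⟩
  rw [Set.eq_univ_iff_forall]
  intro ω
  obtain ⟨s, hs⟩ := hne
  induction hn : {p | ¬ (p ∈ s.1 ↔ p ∈ ω.1)}.ncard using Nat.strong_induction_on generalizing s with
  | _ n ih =>
    by_cases hsω : s = ω
    · rwa [← hsω]
    · obtain ⟨p, s₁, h1, hp⟩ := exists_flip hsω
      have hcard := h1.ncard_add_one hp
      obtain ⟨s', hs', hps'⟩ := exists_mem_side ⟨s, hs⟩ hS p (p ∈ s.1)
      obtain ⟨w⟩ := hconn.preconnected ⟨s, hs⟩ ⟨s', hs'⟩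
      let f : C.wallSpace.graph.induce S →g C.wallSpace.graph :=
        (SimpleGraph.Embedding.induce S).toHom
      have hmem := mem_edges_of_walk h1 (w.map f) Iff.rfl hps'
      have hmem' := SimpleGraph.Walk.snd_mem_support_of_mem_edges _ hmem
      rw [SimpleGraph.Walk.support_map, List.mem_map] at hmem'
      obtain ⟨⟨t, ht⟩, -, rfl⟩ := hmem'
      exact ih _ (by rw [← hn, ← hcard]; exact Nat.lt_succ_self _) t ht rfl

/-- Each peripheral factor fixes a vertex. -/
theorem exists_fixed_vertex (i : ι) : ∃ v : C.wallSpace.Vertex, ∀ a ∈ A i, a • v = v := by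
  choose L hL hL' using fun j => (C.cut j).peripherallyElliptic i
  have := C.ambient.infinite i
  have key : ∀ s t : Set (A i), s.Finite → t.Finite → ∃ a, a ∉ s ∧ a ∉ t := by
    intro s t hs ht
    obtain ⟨a, ha⟩ := (hs.union ht).exists_notMem
    exact ⟨a, fun h => ha (Or.inl h), fun h => ha (Or.inr h)⟩
  -- The vertex chooses, for each wall, the side that contains almost all of `A i`. As `A i` is
  -- infinite, any two chosen sides meet in a point of `A i`.
  refine ⟨⟨{p | p.2 ∈ L p.1}, fun p q => ?_, ?_⟩, fun b hb => ?_⟩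
  · obtain ⟨a, ha, ha'⟩ := key _ _ (hL p.1 p.2) (hL q.1 q.2)
    simp only [Set.mem_ofPred_eq, not_not] at ha ha'
    exact ⟨a, ha.symm, ha'.symm⟩
  · intro x
    refine ((finite_of_slices (s := {p : J × G | ¬ (p ∈ C.wallSpace.pt 1 ↔ p.2 ∈ L p.1)})
      fun j => ?_).union (C.wallSpace.finite_sep 1 x)).subset fun p hp => ?_
    · refine (hL' j).subset fun h hh => ?_
      simpa [mem_pt] using hh
    · simp only [Set.mem_ofPred_eq, Set.mem_union] at hp ⊢
      tauto
  · apply Subtype.ext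
    ext ⟨j, h⟩
    rw [mem_smul]
    change h * b ∈ L j ↔ h ∈ L j
    have hinj : Function.Injective fun a : A i => (⟨b, hb⟩ : A i) * a := mul_right_injective _
    obtain ⟨a, ha, ha'⟩ := key _ _ (hL j (h * b)) ((hL j h).preimage hinj.injOn)
    simp only [Set.mem_ofPred_eq, Set.mem_preimage, not_not] at ha ha'
    rw [← ha, ← ha', Subgroup.coe_mul, mul_assoc]

theorem nontrivial (C : CutFamily A J) [Nonempty J] : Nontrivial C.wallSpace.Vertex := by
  obtain ⟨j⟩ := ‹Nonempty J›
  obtain ⟨x, -, -, hx, -⟩ := (C.cut j).large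
  obtain ⟨y, -, -, hy, -⟩ := (C.cut j).large_compl
  refine ⟨C.wallSpace.point x, C.wallSpace.point y, fun h => ?_⟩
  have h1 : ((j, 1) : J × G) ∈ (C.wallSpace.point x).1 := by
    change 1 * x ∈ C.H j
    simpa using hx
  rw [h] at h1
  change 1 * y ∈ C.H j at h1
  exact hy (by simpa using h1)

theorem cocompact (C : CutFamily A J) [Nonempty J] : ∃ K : Set C.wallSpace.Vertex, K.Finite ∧
    ∀ v w, (v = w ∨ C.wallSpace.graph.Adj v w) → ∃ g : G, g • v ∈ K ∧ g • w ∈ K := by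
  let K : J → Set C.wallSpace.Vertex :=
    fun j => {ω | ∃ ω' : C.wallSpace.Vertex, DiffersAt (j, 1) ω.1 ω'.1}
  have key : ∀ v w, C.wallSpace.graph.Adj v w → ∃ g : G, g • v ∈ ⋃ j, K j ∧ g • w ∈ ⋃ j, K j := by
    rintro v w ⟨⟨j, h⟩, hd⟩
    have := differsAt_smul hd h
    rw [mul_inv_cancel] at this
    exact ⟨h, Set.mem_iUnion.2 ⟨j, _, this⟩, Set.mem_iUnion.2 ⟨j, _, this.symm⟩⟩
  refine ⟨⋃ j, K j, Set.finite_iUnion fun j => ?_, ?_⟩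
  -- A single edge crosses the wall `(j, 1)`, and its endpoints are told apart by their sides.
  · refine Set.Finite.of_injOn (f := fun ω : C.wallSpace.Vertex => ((j, 1) : J × G) ∈ ω.1)
      (t := Set.univ) (fun _ _ => Set.mem_univ _) ?_ Set.finite_univ
    rintro ω ⟨ω', h⟩ α ⟨α', h'⟩ he
    exact eq_of_differsAt h h' (iff_of_eq he)
  · rintro v w (rfl | h)
    · have := C.nontrivial
      obtain ⟨w, hw⟩ := C.wallSpace.isTree.1.preconnected.exists_adj_of_nontrivial v
      obtain ⟨g, hg, -⟩ := key v w hw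
      exact ⟨g, hg, hg⟩
    · exact key v w h

/-- At a vertex of degree two both of whose edges are crossed by translates of the same cut, the
two edges are interchanged by an element of `G`. -/
theorem exists_interchange [Nonempty J] {v x y : C.wallSpace.Vertex} {j : J} {h₁ h₂ : G}
    (hv : C.wallSpace.graph.neighborSet v = {x, y}) (hx : DiffersAt (j, h₁) v.1 x.1)
    (hy : DiffersAt (j, h₂) v.1 y.1) (hxy : x ≠ y) :
    ∃ g : G, g • v = v ∧ g • x = y ∧ g • y = x := by
  have hadj : ∀ w, C.wallSpace.graph.Adj v w ↔ w = x ∨ w = y := by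
    intro w
    rw [← SimpleGraph.mem_neighborSet, hv]
    rfl
  have hne : v ≠ y := by
    rintro rfl
    exact hy.ne rfl
  set m : G := h₂⁻¹ * h₁ with hm
  have hmx := differsAt_smul hx m
  have e : h₁ * m⁻¹ = h₂ := by simp [hm]
  simp only [e] at hmx
  -- The element `m` takes one edge at `v` to the other. If it fixes `v`, it is the required
  -- interchange; otherwise it shifts along the two edges.
  by_cases hside : (j, h₂) ∈ v.1 ↔ (j, h₂) ∈ (m • v).1
  · have h1 := eq_of_differsAt hy hmx hside
    have h2 := eq_of_differsAt_right hy hmx hside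
    refine ⟨m, h1.symm, h2.symm, ?_⟩
    have h3 := adj_smul ((hadj y).2 (Or.inr rfl)) m
    rw [← h1, hadj] at h3
    rcases h3 with h3 | h3
    · exact h3
    · exfalso
      exact hxy (smul_left_cancel m (h3.trans h2)).symm
  · exfalso
    have hs : (j, h₂) ∈ y.1 ↔ (j, h₂) ∈ (m • v).1 := by
      have := hy.not_iff
      tauto
    have h1 : y = m • v := eq_of_differsAt hy.symm hmx hs
    have h2 : v = m • x := eq_of_differsAt_right hy.symm hmx hs
    have hx' : x = m⁻¹ • v := by rw [h2, inv_smul_smul]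
    -- In the shifting case the tree is a line on which `m` translates by one. Vertex stabilizers
    -- are trivial, so `G` would be generated by `m`, contrary to noncommutativity.
    have hall : ∀ w, ∃ n : ℤ, w = m ^ n • v := by
      intro w
      obtain ⟨p⟩ := C.wallSpace.isTree.1.preconnected w v
      induction hp : p.length generalizing w with
      | zero => exact ⟨0, by simpa using p.eq_of_length_eq_zero hp⟩
      | succ n ih =>
        cases p with
        | nil => exact ⟨0, by simp⟩
        | @cons _ w' _ hw q =>
          obtain ⟨n, rfl⟩ := ih w' q (by simpa using hp)
          have := adj_smul hw.symm (m ^ n)⁻¹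
          rw [inv_smul_smul, hadj, inv_smul_eq_iff, inv_smul_eq_iff, hx', h1, smul_smul,
            smul_smul] at this
          rcases this with h | h
          · exact ⟨n - 1, by rw [h, zpow_sub_one]⟩
          · exact ⟨n + 1, by rw [h, zpow_add_one]⟩
    have hstab : ∀ k : G, k • v = v → k = 1 := by
      intro k hk
      have h3 := adj_smul ((hadj x).2 (Or.inl rfl)) k
      rw [hk, hadj] at h3
      rcases h3 with h3 | h3
      · exact eq_one_of_smul_edge ((hadj x).2 (Or.inl rfl)) (by rw [h3, hk])
      · exfalso
        have h4 := differsAt_smul hx k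
        rw [hk, h3] at h4
        have h5 := h4.wall_unique hy
        have h6 : k = m := by
          simp only [Prod.mk.injEq, true_and] at h5
          rw [hm, ← h5]
          group
        rw [h6] at hk
        exact hne (by rw [h1, hk])
    have hcyc : ∀ k : G, ∃ n : ℤ, k = m ^ n := by
      intro k
      obtain ⟨n, hn⟩ := hall (k • v)
      refine ⟨n, ?_⟩
      have := hstab ((m ^ n)⁻¹ * k) (by rw [mul_smul, hn, inv_smul_smul])
      rw [inv_mul_eq_one] at this
      exact this.symm
    obtain ⟨a, b, hab⟩ := C.ambient.noncomm
    obtain ⟨s, rfl⟩ := hcyc a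
    obtain ⟨t, rfl⟩ := hcyc b
    exact hab (by rw [← zpow_add, ← zpow_add, add_comm])

variable (C)

/-- No vertex of the dual tree has degree two with its two edges crossed by translates of different
cuts. -/
def NoMixedDegreeTwo : Prop :=
  ∀ (v x y : C.wallSpace.Vertex) (p q : J × G), C.wallSpace.graph.neighborSet v = {x, y} →
    DiffersAt p v.1 x.1 → DiffersAt q v.1 y.1 → p.1 = q.1

/-- The tree dual to a family of cuts, with edges of length one. -/
noncomputable def dual [Nonempty J] (hC : C.NoMixedDegreeTwo) : GATree A where
  V := C.wallSpace.Vertex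
  graph := C.wallSpace.graph
  isTree := C.wallSpace.isTree
  nontrivial := C.nontrivial
  adj_smul k _ _ h := adj_smul h k
  no_inversion k v w h h' := by
    have h1 := eq_one_of_smul_edge h (k := k) (by rw [h'.1, h'.2, Sym2.eq_swap])
    rw [h1, one_smul] at h'
    exact h.ne h'.1
  len _ := 1
  len_pos _ _ _ := one_pos
  len_smul _ _ _ _ := rfl
  minimal _ hS hS' := eq_univ_of_invariant hS hS'
  cocompact := C.cocompact
  peripheral_fix := exists_fixed_vertex
  degree_two v x y hxy hv := by
    obtain ⟨⟨j, h₁⟩, hx⟩ : C.wallSpace.graph.Adj v x := by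
      rw [← SimpleGraph.mem_neighborSet, hv]
      exact Or.inl rfl
    obtain ⟨⟨j', h₂⟩, hy⟩ : C.wallSpace.graph.Adj v y := by
      rw [← SimpleGraph.mem_neighborSet, hv]
      exact Or.inr rfl
    obtain rfl : j = j' := hC v x y _ _ hv hx hy
    exact exists_interchange hv hx hy hxy

theorem isFreeSplitting_dual [Nonempty J] (hC : C.NoMixedDegreeTwo) :
    (C.dual hC).IsFreeSplitting := by
  have h : ∀ v w, (C.dual hC).graph.Adj v w → (C.dual hC).edgeStab v w = ⊥ := by
    intro v w hvw
    rw [Subgroup.eq_bot_iff_forall]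
    rintro k ⟨h1, h2⟩
    exact eq_one_of_smul_edge hvw (congrArg₂ (fun a b => s(a, b)) h1 h2)
  exact ⟨⟨fun _ _ _ => rfl, fun v w hvw => Or.inl (h v w hvw)⟩, h⟩

/-- The cut family consisting of a single cut. -/
def single (hA : Ambient A) {H : Set G} (hH : IsCut A H) : CutFamily A Unit where
  ambient := hA
  H _ := H
  cut _ := hH
  nested _ _ h := absurd rfl h
  exists_ne _ _ h := absurd rfl h
  exists_eq _ _ h := absurd rfl h

theorem noMixedDegreeTwo_single (hA : Ambient A) {H : Set G} (hH : IsCut A H) :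
    (single hA hH).NoMixedDegreeTwo := fun _ _ _ _ _ _ _ _ => rfl

end CutFamily

/-- The tree dual to a single cut. -/
noncomputable def cutTree (hA : Ambient A) {H : Set G} (hH : IsCut A H) : GATree A :=
  (CutFamily.single hA hH).dual (CutFamily.noMixedDegreeTwo_single hA hH)

/-- An equivariant simplicial map is surjective, by minimality of the target. -/
theorem surjective_of_equivariant {T T' : GATree A} (f : T.V → T'.V)
    (hf : ∀ (g : G) (v : T.V), f (g • v) = g • f v)
    (hadj : ∀ v w : T.V, T.graph.Adj v w → f v = f w ∨ T'.graph.Adj (f v) (f w)) :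
    Function.Surjective f := by
  rw [← Set.range_eq_univ]
  apply T'.minimal
  · have : Nonempty T.V := T.isTree.1.nonempty
    have hne : Nonempty (Set.range f) := inferInstance
    refine ⟨?_⟩
    have key : ∀ v w (p : T.graph.Walk v w),
        (T'.graph.induce (Set.range f)).Reachable ⟨f v, v, rfl⟩ ⟨f w, w, rfl⟩ := by
      intro v w p
      induction p with
      | nil => exact .rfl
      | @cons a b c hab q ih =>
        refine .trans ?_ ih
        rcases hadj a b hab with h | h
        · have : (⟨f a, a, rfl⟩ : Set.range f) = ⟨f b, b, rfl⟩ := Subtype.ext h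
          rw [this]
        · exact SimpleGraph.Adj.reachable (by simpa using h)
    rintro ⟨_, v, rfl⟩ ⟨_, w, rfl⟩
    obtain ⟨p⟩ := T.isTree.1.preconnected v w
    exact key v w p
  · rintro g _ ⟨v, rfl⟩
    exact ⟨g • v, hf g v⟩

/-- An equivariant simplicial map with preconnected fibres is a collapse. -/
theorem collapses_of_walks {T T' : GATree A} (f : T.V → T'.V)
    (hf : ∀ (g : G) (v : T.V), f (g • v) = g • f v)
    (hadj : ∀ v w : T.V, T.graph.Adj v w → f v = f w ∨ T'.graph.Adj (f v) (f w))
    (hfib : ∀ v w, f v = f w → ∃ p : T.graph.Walk v w, ∀ u ∈ p.support, f u = f v) :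
    T.Collapses T' := by
  refine ⟨f, hf, hadj, fun x => ?_⟩
  obtain ⟨v, rfl⟩ := surjective_of_equivariant f hf hadj x
  have hne : Nonempty (f ⁻¹' {f v}) := ⟨⟨v, rfl⟩⟩
  refine ⟨?_⟩
  rintro ⟨a, ha⟩ ⟨b, hb⟩
  obtain ⟨p, hp⟩ := hfib a b (by rw [Set.mem_preimage, Set.mem_singleton_iff] at ha hb; rw [ha, hb])
  have hp' : ∀ u ∈ p.support, u ∈ f ⁻¹' {f v} := by
    intro u hu
    rw [Set.mem_preimage, Set.mem_singleton_iff] at ha ⊢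
    rw [hp u hu, ha]
  exact (p.induce _ hp').reachable

namespace CutFamily

open WallSpace

variable {J : Type} [Finite J]

/-- Forgetting all but one of the cuts of a family. -/
def restrict (C : CutFamily A J) (j : J) (ω : C.wallSpace.Vertex) :
    (single C.ambient (C.cut j)).wallSpace.Vertex :=
  ⟨{p | (j, p.2) ∈ ω.1}, fun p q => ω.2.1 (j, p.2) (j, q.2), fun x =>
    ((ω.2.2 x).preimage (f := fun p : Unit × G => (j, p.2))
      (fun a _ b _ hab => Prod.ext rfl ((Prod.mk.inj (show (j, a.2) = (j, b.2) from hab)).2)))⟩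

theorem mem_restrict {C : CutFamily A J} {j : J} {ω : C.wallSpace.Vertex} {p : Unit × G} :
    p ∈ (restrict C j ω).1 ↔ (j, p.2) ∈ ω.1 := Iff.rfl

theorem restrict_eq_iff {C : CutFamily A J} {j : J} {ω ω' : C.wallSpace.Vertex} :
    restrict C j ω = restrict C j ω' ↔ ∀ h, (j, h) ∈ ω.1 ↔ (j, h) ∈ ω'.1 := by
  constructor
  · intro h k
    have := congrArg (fun v => ((), k) ∈ v.1) h
    exact iff_of_eq this
  · intro h
    apply Subtype.ext
    ext p
    exact h p.2

theorem restrict_adj {C : CutFamily A J} {j : J} {ω ω' : C.wallSpace.Vertex}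
    (h : C.wallSpace.graph.Adj ω ω') : restrict C j ω = restrict C j ω' ∨
      (single C.ambient (C.cut j)).wallSpace.graph.Adj (restrict C j ω) (restrict C j ω') := by
  obtain ⟨⟨j', h₀⟩, hd⟩ := h
  by_cases hj : j = j'
  · subst hj
    right
    refine ⟨((), h₀), fun q => ?_⟩
    rw [mem_restrict, mem_restrict, hd]
    simp [Prod.ext_iff]
  · left
    rw [restrict_eq_iff]
    intro k
    exact hd.iff_of_ne (by simp [hj])

theorem restrict_fibre {C : CutFamily A J} {j : J} {ω ω' : C.wallSpace.Vertex}
    (h : restrict C j ω = restrict C j ω') :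
    ∃ p : C.wallSpace.graph.Walk ω ω', ∀ α ∈ p.support, restrict C j α = restrict C j ω := by
  obtain ⟨p, -, hp⟩ := exists_walk ω ω'
  rw [restrict_eq_iff] at h
  exact ⟨p, fun α hα => restrict_eq_iff.2 fun k => hp α hα _ (h k)⟩

theorem collapses_cutTree (C : CutFamily A J) [Nonempty J] (hC : C.NoMixedDegreeTwo) (j : J) :
    (C.dual hC).Collapses (cutTree C.ambient (C.cut j)) :=
  collapses_of_walks (T := C.dual hC) (T' := cutTree C.ambient (C.cut j)) (restrict C j)
    (fun _ _ => rfl) (fun _ _ h => restrict_adj h) (fun _ _ h => restrict_fibre h)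

end CutFamily

end Cuts

/-! ### Translation lengths and axes -/

section Axes

variable {G : Type u} [Group G] {ι : Type*} {A : ι → Subgroup G}

/-- The length of a path is at least the distance of its endpoints. -/
theorem dist_le_of_adj {V : Type*} {Γ : SimpleGraph V} (hΓ : Γ.Connected) {γ : ℤ → V}
    (h : ∀ n, Γ.Adj (γ n) (γ (n + 1))) (n : ℤ) (k : ℕ) : Γ.dist (γ n) (γ (n + k)) ≤ k := by
  induction k with
  | zero => simp
  | succ k ih =>
    have h1 := hΓ.dist_triangle (u := γ n) (v := γ (n + k)) (w := γ (n + k + 1))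
    rw [SimpleGraph.dist_eq_one_iff_adj.2 (h (n + k))] at h1
    push_cast
    rw [← add_assoc]
    omega

/-- In a tree, paths without backtracking are geodesics. -/
theorem dist_eq_of_ne {V : Type*} {Γ : SimpleGraph V} (hΓ : Γ.IsTree) {γ : ℤ → V}
    (h : ∀ n, Γ.Adj (γ n) (γ (n + 1))) (h' : ∀ n, γ n ≠ γ (n + 2)) (n : ℤ) (k : ℕ) :
    Γ.dist (γ n) (γ (n + k)) = k := by
  suffices H : Γ.dist (γ n) (γ (n + k)) = k ∧ Γ.dist (γ n) (γ (n + k + 1)) = k + 1 from H.1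
  induction k with
  | zero => simpa using h n
  | succ k ih =>
    obtain ⟨h1, h2⟩ := ih
    push_cast
    rw [← add_assoc]
    refine ⟨h2, ?_⟩
    have hadj := h (n + k + 1)
    rcases hΓ.dist_eq_dist_add_one_of_adj (γ n) hadj with h3 | h3
    · exfalso
      apply h' (n + k)
      have e : n + (k : ℤ) + 2 = n + k + 1 + 1 := by ring
      rw [e]
      refine dir_unique hΓ (x := γ n) (h (n + k)).symm ?_ hadj ?_
      · unfold Side
        rw [Γ.dist_comm, Γ.dist_comm (u := γ (n + k + 1)), h1, h2]
        omega
      · unfold Side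
        rw [Γ.dist_comm, Γ.dist_comm (u := γ (n + k + 1))]
        omega
    · omega

namespace GATree

theorem dist_smul (T : GATree A) (k : G) (v w : T.V) :
    T.graph.dist (k • v) (k • w) = T.graph.dist v w := by
  have key : ∀ (k : G) (v w : T.V), T.graph.dist (k • v) (k • w) ≤ T.graph.dist v w := by
    intro k v w
    obtain ⟨p, hp⟩ := T.isTree.1.exists_walk_length_eq_dist v w
    let f : T.graph →g T.graph := ⟨fun v => k • v, fun h => T.adj_smul k _ _ h⟩
    have := T.graph.dist_le (p.map f)
    rwa [SimpleGraph.Walk.length_map, hp] at this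
  refine le_antisymm (key k v w) ?_
  have := key k⁻¹ (k • v) (k • w)
  rwa [inv_smul_smul, inv_smul_smul] at this

theorem side_smul (T : GATree A) (k : G) {a b v : T.V} :
    Side T.graph (k • a) (k • b) (k • v) ↔ Side T.graph a b v := by
  unfold Side
  rw [dist_smul, dist_smul]

theorem dir_smul (T : GATree A) (k : G) {u x : T.V} (h : u ≠ x) :
    dir T.graph (k • u) (k • x) = k • dir T.graph u x := by
  refine dir_eq T.isTree (T.adj_smul k _ _ (dir_adj T.isTree h)) ?_
  rw [side_smul]
  exact side_dir T.isTree h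

/-- The minimal displacement of a vertex under `g`. -/
noncomputable def transLength (T : GATree A) (g : G) : ℕ :=
  sInf (Set.range fun v : T.V => T.graph.dist v (g • v))

theorem transLength_le (T : GATree A) (g : G) (v : T.V) :
    T.transLength g ≤ T.graph.dist v (g • v) := Nat.sInf_le ⟨v, rfl⟩

theorem exists_dist_eq_transLength (T : GATree A) (g : G) :
    ∃ v : T.V, T.graph.dist v (g • v) = T.transLength g := by
  have : Nonempty T.V := T.isTree.1.nonempty
  exact Nat.sInf_mem (Set.range_nonempty fun v : T.V => T.graph.dist v (g • v))

theorem elliptic_of_transLength_eq_zero {T : GATree A} {g : G} (h : T.transLength g = 0) :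
    T.Elliptic g := by
  obtain ⟨v, hv⟩ := T.exists_dist_eq_transLength g
  rw [h, T.isTree.1.dist_eq_zero_iff] at hv
  exact ⟨v, hv.symm⟩

/-- `γ` is an axis of `g` with translation length `ℓ`. -/
structure IsAxis (T : GATree A) (g : G) (ℓ : ℕ) (γ : ℤ → T.V) : Prop where
  pos : 0 < ℓ
  adj : ∀ n, T.graph.Adj (γ n) (γ (n + 1))
  ne : ∀ n, γ n ≠ γ (n + 2)
  smul : ∀ n, g • γ n = γ (n + ℓ)

/-- The axis is the union of the translates under powers of `g` of a geodesic from `v` to `g • v`,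
where `v` has minimal displacement. -/
theorem exists_isAxis {T : GATree A} {g : G} (h : 0 < T.transLength g) :
    ∃ γ, T.IsAxis g (T.transLength g) γ := by
  obtain ⟨v, hv⟩ := T.exists_dist_eq_transLength g
  have hmin := T.transLength_le g
  generalize T.transLength g = ℓ at h hv hmin
  obtain ⟨p, hp⟩ := T.isTree.1.exists_walk_length_eq_dist v (g • v)
  have hpath := p.isPath_of_length_eq_dist hp
  rw [hv] at hp
  have hℓ : (0 : ℤ) < ℓ := by exact_mod_cast h
  let γ : ℤ → T.V := fun n => g ^ (n / ℓ) • p.getVert (n % ℓ).toNat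
  have hγ : ∀ (q : ℤ) (r : ℕ), r ≤ ℓ → γ (q * ℓ + r) = g ^ q • p.getVert r := by
    intro q r hr
    rcases hr.lt_or_eq with hr | rfl
    · have h1 : (q * ℓ + r) / (ℓ : ℤ) = q := by
        rw [add_comm, Int.add_mul_ediv_right _ _ hℓ.ne', Int.ediv_eq_zero_of_lt] <;> omega
      have h2 : (q * ℓ + r) % (ℓ : ℤ) = r := by
        rw [add_comm, Int.add_mul_emod_self_right]
        exact Int.emod_eq_of_lt (by omega) (by omega)
      simp only [γ, h1, h2, Int.toNat_natCast]
    · have h0 : q * (r : ℤ) + r = (q + 1) * r := by ring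
      have h1 : ((q + 1) * (r : ℤ)) / (r : ℤ) = q + 1 := Int.mul_ediv_cancel _ hℓ.ne'
      have h2 : ((q + 1) * (r : ℤ)) % (r : ℤ) = 0 := Int.mul_emod_left _ _
      have h3 : p.getVert r = g • v := by
        rw [← hp]
        exact p.getVert_length
      simp only [γ, h0, h1, h2, h3, zpow_add_one, mul_smul, Int.toNat_zero,
        SimpleGraph.Walk.getVert_zero]
  have hdec : ∀ n : ℤ, ∃ (q : ℤ) (r : ℕ), r < ℓ ∧ n = q * ℓ + r := by
    intro n
    have h1 := Int.emod_nonneg n hℓ.ne'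
    have h2 := Int.emod_lt_of_pos n hℓ
    refine ⟨n / ℓ, (n % ℓ).toNat, by omega, ?_⟩
    rw [Int.toNat_of_nonneg h1, mul_comm]
    exact (Int.mul_ediv_add_emod n ℓ).symm
  have hsmul : ∀ n, g • γ n = γ (n + ℓ) := by
    intro n
    obtain ⟨q, r, hr, rfl⟩ := hdec n
    have e : q * (ℓ : ℤ) + r + ℓ = (q + 1) * ℓ + r := by ring
    rw [e, hγ q r hr.le, hγ (q + 1) r hr.le, smul_smul, zpow_add_one, (Commute.zpow_self g q).eq]
  have hadj : ∀ n, T.graph.Adj (γ n) (γ (n + 1)) := by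
    intro n
    obtain ⟨q, r, hr, rfl⟩ := hdec n
    have e : q * (ℓ : ℤ) + r + 1 = q * ℓ + (r + 1 : ℕ) := by push_cast; ring
    rw [e, hγ q r hr.le, hγ q (r + 1) hr]
    exact T.adj_smul _ _ _ (p.adj_getVert_succ (by omega))
  refine ⟨γ, h, hadj, ?_, hsmul⟩
  intro n hn
  obtain ⟨q, r, hr, rfl⟩ := hdec n
  by_cases hr2 : r + 2 ≤ ℓ
  · have e : q * (ℓ : ℤ) + r + 2 = q * ℓ + (r + 2 : ℕ) := by push_cast; ring
    rw [e, hγ q r hr.le, hγ q (r + 2) hr2] at hn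
    have h1 := smul_left_cancel _ hn
    have h2 := hpath.getVert_injOn (by simp only [Set.mem_ofPred_eq]; omega)
      (by simp only [Set.mem_ofPred_eq]; omega) h1
    omega
  · obtain rfl : ℓ = r + 1 := by omega
    -- Backtracking can only happen where two translates of the geodesic meet. Then `γ 1` is moved
    -- by at most ℓ - 2, against minimality, or, if ℓ = 1, the edge is inverted.
    have h1 : γ r = γ (r + 2) := by
      have e1 : q * ((r + 1 : ℕ) : ℤ) + r + 2 = (q + 1) * (r + 1 : ℕ) + (1 : ℕ) := by
        push_cast; ring
      have e2 : ((r : ℤ) + 2) = 1 * (r + 1 : ℕ) + (1 : ℕ) := by push_cast; ring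
      have e3 : (r : ℤ) = 0 * (r + 1 : ℕ) + r := by ring
      rw [e1, hγ q r hr.le, hγ (q + 1) 1 (by omega), zpow_add_one, mul_smul] at hn
      have := smul_left_cancel _ hn
      rw [e2, hγ 1 1 (by omega)]
      nth_rw 1 [e3]
      rw [hγ 0 r hr.le, this, zpow_zero, one_smul, zpow_one]
    rcases Nat.eq_zero_or_pos r with rfl | hr0
    · refine T.no_inversion g (γ 0) (γ (0 + 1)) (hadj 0) ⟨?_, ?_⟩
      · rw [hsmul]; simp
      · rw [hsmul]
        simp only [Nat.cast_zero, zero_add] at h1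
        rw [h1]
        norm_num
    · have h2 := hmin (γ 1)
      rw [hsmul] at h2
      have e1 : (1 : ℤ) + (r + 1 : ℕ) = r + 2 := by push_cast; ring
      have e2 : (r : ℤ) = 1 + (r - 1 : ℕ) := by omega
      rw [e1, ← h1, e2] at h2
      have h3 := dist_le_of_adj T.isTree.1 hadj 1 (r - 1)
      omega

namespace IsAxis

variable {T : GATree A} {g : G} {ℓ : ℕ} {γ : ℤ → T.V}

theorem dist_eq (h : T.IsAxis g ℓ γ) (n : ℤ) (k : ℕ) : T.graph.dist (γ n) (γ (n + k)) = k :=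
  dist_eq_of_ne T.isTree h.adj h.ne n k

theorem injective (h : T.IsAxis g ℓ γ) : Function.Injective γ := by
  have key : ∀ m n, m ≤ n → γ m = γ n → m = n := by
    intro m n hmn he
    have := h.dist_eq m (n - m).toNat
    rw [Int.toNat_of_nonneg (by omega), add_sub_cancel, he, SimpleGraph.dist_self] at this
    omega
  intro m n he
  rcases le_total m n with hmn | hmn
  · exact key m n hmn he
  · exact (key n m hmn he.symm).symm

theorem zpow_smul (h : T.IsAxis g ℓ γ) (k n : ℤ) : g ^ k • γ n = γ (n + k * ℓ) := by
  induction k using Int.induction_on generalizing n with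
  | zero => simp
  | succ k ih =>
    rw [zpow_add_one, mul_smul, h.smul, ih]
    congr 1
    ring
  | pred k ih =>
    rw [zpow_sub_one, mul_smul]
    have : g⁻¹ • γ n = γ (n - ℓ) := by
      rw [inv_smul_eq_iff, h.smul, sub_add_cancel]
    rw [this, ih]
    congr 1
    ring

theorem eq_of_edge_eq (h : T.IsAxis g ℓ γ) {m n : ℤ}
    (he : s(γ m, γ (m + 1)) = s(γ n, γ (n + 1))) : m = n := by
  rcases Sym2.eq_iff.1 he with ⟨h1, -⟩ | ⟨h1, h2⟩
  · exact h.injective h1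
  · have h1 := h.injective h1
    have h2 := h.injective h2
    omega

theorem isInvariantLine (h : T.IsAxis g ℓ γ) : T.IsInvariantLine g γ := by
  refine ⟨h.injective, h.adj, ?_⟩
  ext v
  constructor
  · rintro ⟨_, ⟨n, rfl⟩, rfl⟩
    exact ⟨n + ℓ, (h.smul n).symm⟩
  · rintro ⟨n, rfl⟩
    refine ⟨_, ⟨n - ℓ, rfl⟩, ?_⟩
    change g • _ = _
    rw [h.smul, sub_add_cancel]

/-- Powers of `g` shift the edges of the axis by multiples of `ℓ`, so `ℓ` consecutive edges lie in
different orbits. -/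
theorem le_combLength (h : T.IsAxis g ℓ γ) : (ℓ : ℕ∞) ≤ T.combLength g := by
  have hinj : Set.InjOn (fun i : ℕ => T.cyclicOrbit g s(γ i, γ (i + 1)))
      (Finset.range ℓ : Set ℕ) := by
    intro i hi j hj hij
    have h1 : s(γ i, γ (i + 1)) ∈ T.cyclicOrbit g s(γ j, γ (j + 1)) := by
      simp only at hij
      rw [← hij]
      exact ⟨0, by simp⟩
    obtain ⟨n, hn⟩ := h1
    simp only [Sym2.map_mk, h.zpow_smul] at hn
    have e : (j : ℤ) + 1 + n * ℓ = j + n * ℓ + 1 := by ring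
    rw [e] at hn
    have h2 := h.eq_of_edge_eq hn
    simp only [Finset.coe_range, Set.mem_Iio] at hi hj
    have hn0 : n = 0 := by
      have h3 : n * ℓ < 1 * ℓ := by omega
      have h4 : (-1) * ℓ < n * ℓ := by omega
      have hpos : (0 : ℤ) < ℓ := by omega
      have h5 := lt_of_mul_lt_mul_right h3 hpos.le
      have h6 := lt_of_mul_lt_mul_right h4 hpos.le
      omega
    rw [hn0] at h2
    omega
  have hsub : (fun i : ℕ => T.cyclicOrbit g s(γ i, γ (i + 1))) '' (Finset.range ℓ : Set ℕ) ⊆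
      T.cyclicOrbit g '' T.axisEdges g := by
    rintro _ ⟨i, -, rfl⟩
    exact ⟨_, ⟨γ, h.isInvariantLine, i, rfl⟩, rfl⟩
  have := Set.encard_le_encard hsub
  rw [hinj.encard_image, Set.encard_coe_eq_coe_finsetCard, Finset.card_range] at this
  exact this

end IsAxis

theorem elliptic_of_isOfFinOrder (T : GATree A) {k : G} (hk : IsOfFinOrder k) : T.Elliptic k := by
  by_contra h
  have hpos : 0 < T.transLength k := by
    rw [Nat.pos_iff_ne_zero]
    exact fun h0 => h (elliptic_of_transLength_eq_zero h0)
  obtain ⟨γ, hγ⟩ := exists_isAxis hpos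
  obtain ⟨n, hn, hkn⟩ := isOfFinOrder_iff_pow_eq_one.1 hk
  have h1 := hγ.zpow_smul n 0
  rw [zpow_natCast, hkn, one_smul] at h1
  have h2 := hγ.injective h1
  have : (n : ℤ) * T.transLength k ≠ 0 := by positivity
  omega

end GATree

end Axes

/-! ### The cut defined by an edge of a tree, and the collapse to its dual tree -/

section Traces

variable {G : Type u} [Group G] {ι : Type*} {A : ι → Subgroup G}

open WallSpace CutFamily

/-- The edge from `a` to `b` has trivial stabilizer. -/
def FreeEdge (T : GATree A) (a b : T.V) : Prop :=
  T.graph.Adj a b ∧ ∀ k : G, k • a = a → k • b = b → k = 1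

/-- As inversions are excluded, the unoriented edge also has trivial stabilizer; its translates can
therefore be indexed by `G`. -/
theorem FreeEdge.eq_of_edge_eq {T : GATree A} {a b : T.V} (h : FreeEdge T a b) {k k' : G}
    (he : s(k • a, k • b) = s(k' • a, k' • b)) : k = k' := by
  rcases Sym2.eq_iff.1 he with ⟨h1, h2⟩ | ⟨h1, h2⟩
  · have := h.2 (k'⁻¹ * k) (by rw [mul_smul, h1, inv_smul_smul]) (by rw [mul_smul, h2, inv_smul_smul])
    rw [inv_mul_eq_one] at this
    exact this.symm
  · exfalso
    refine T.no_inversion (k'⁻¹ * k) a b h.1 ⟨?_, ?_⟩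
    · rw [mul_smul, h1, inv_smul_smul]
    · rw [mul_smul, h2, inv_smul_smul]

theorem FreeEdge.eq_of_smul_edge_eq {T : GATree A} {a b u w : T.V} (h : FreeEdge T a b) {k k' : G}
    (hk : s(k • u, k • w) = s(a, b)) (hk' : s(k' • u, k' • w) = s(a, b)) : k = k' := by
  have key : ∀ k : G, s(k • u, k • w) = s(a, b) → s(u, w) = s(k⁻¹ • a, k⁻¹ • b) := by
    intro k hk
    have := congrArg (Sym2.map fun v => k⁻¹ • v) hk
    simpa using this
  exact inv_injective (h.eq_of_edge_eq ((key k hk).symm.trans (key k' hk')))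

theorem edge_eq_of_not_side_iff {T : GATree A} {a b u w : T.V} (hab : T.graph.Adj a b)
    (huw : T.graph.Adj u w) (h : ¬ (Side T.graph a b u ↔ Side T.graph a b w)) :
    s(u, w) = s(a, b) := by
  by_cases hu : Side T.graph a b u
  · obtain ⟨rfl, rfl⟩ := eq_of_side_of_not_side T.isTree hab huw hu (by tauto)
    exact Sym2.eq_swap
  · obtain ⟨rfl, rfl⟩ := eq_of_side_of_not_side T.isTree hab huw.symm (by tauto) hu
    rfl

theorem not_side_iff_of_edge_eq {T : GATree A} {a b u d w : T.V} (hab : T.graph.Adj a b)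
    (hs : Side T.graph u d w) (he : s(u, d) = s(a, b)) :
    ¬ (Side T.graph a b u ↔ Side T.graph a b w) := by
  rcases Sym2.eq_iff.1 he with ⟨rfl, rfl⟩ | ⟨rfl, rfl⟩
  · intro h
    exact not_side_left (h.2 hs)
  · intro h
    rw [← not_side_iff T.isTree hab] at hs
    exact hs (h.1 (side_right hab))

/-- Each edge of a walk from `u` to `w` is taken to the given edge by at most one element of `G`. -/
theorem FreeEdge.finite_sep {T : GATree A} {a b : T.V} (h : FreeEdge T a b) (u w : T.V) :
    {k : G | ¬ (Side T.graph a b (k • u) ↔ Side T.graph a b (k • w))}.Finite := by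
  obtain ⟨p⟩ := T.isTree.1.preconnected u w
  induction p with
  | nil => simp
  | @cons u v w huv p ih =>
    refine Set.Finite.subset (Set.Finite.union (s :=
      {k : G | ¬ (Side T.graph a b (k • u) ↔ Side T.graph a b (k • v))}) ?_ ih) ?_
    · apply Set.Subsingleton.finite
      intro k hk k' hk'
      exact h.eq_of_smul_edge_eq
        (edge_eq_of_not_side_iff h.1 (T.adj_smul _ _ _ huv) hk)
        (edge_eq_of_not_side_iff h.1 (T.adj_smul _ _ _ huv) hk')
    · intro k hk
      simp only [Set.mem_union, Set.mem_ofPred_eq] at hk ⊢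
      tauto

theorem nested_side_smul {T : GATree A} {a b : T.V} (hab : T.graph.Adj a b) (k k' : G) :
    Nested (fun u => Side T.graph a b (k • u)) (fun u => Side T.graph a b (k' • u)) := by
  have e : ∀ k : G, (fun u => Side T.graph a b (k • u)) = Side T.graph (k⁻¹ • a) (k⁻¹ • b) := by
    intro k
    funext u
    rw [← T.side_smul k (a := k⁻¹ • a), smul_inv_smul, smul_inv_smul]
  rw [e, e]
  exact nested_side T.isTree (T.adj_smul _ _ _ hab) (T.adj_smul _ _ _ hab)

/-- The elements of `G` that take the vertex `y` to a given side of an edge. -/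
def trace (T : GATree A) (a b y : T.V) : Set G := {x | Side T.graph a b (x • y)}

theorem mem_trace {T : GATree A} {a b y : T.V} {x : G} :
    x ∈ trace T a b y ↔ Side T.graph a b (x • y) := Iff.rfl

theorem FreeEdge.finiteSep_trace {T : GATree A} {a b : T.V} (h : FreeEdge T a b) (y : T.V) :
    FiniteSep (trace T a b y) := by
  intro x x'
  refine (h.finite_sep (x • y) (x' • y)).subset fun k hk => ?_
  simpa only [Set.mem_ofPred_eq, mem_trace, mul_smul] using hk

theorem FreeEdge.peripherallyElliptic_trace {T : GATree A} {a b : T.V} (h : FreeEdge T a b)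
    (y : T.V) : PeripherallyElliptic A (trace T a b y) := by
  intro i
  obtain ⟨v, hv⟩ := T.peripheral_fix i
  have hfin := h.finite_sep y v
  -- The limit is read off at a vertex `v` fixed by `A i`: the vertices `c • y` with `c` in `A i`
  -- are on the side of `v` for almost all `c`.
  refine ⟨{k | Side T.graph a b (k • v)}, fun k => ?_, hfin.subset fun k hk => hk⟩
  have hinj : Function.Injective fun c : A i => k * (c : G) :=
    (mul_right_injective k).comp Subtype.val_injective
  refine (hfin.preimage hinj.injOn).subset ?_
  rintro ⟨c, hc⟩ hk
  simp only [Set.mem_ofPred_eq, Set.mem_preimage, mem_trace, mul_smul, hv c hc] at hk ⊢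
  exact hk

theorem nested_trace {T : GATree A} {a b : T.V} (h : T.graph.Adj a b) (y : T.V) (k : G) :
    Nested (fun x => x ∈ trace T a b y) (fun x => k * x ∈ trace T a b y) := by
  have := (nested_side_smul h 1 k).comp (fun x : G => x • y)
  simp only [smul_smul, one_mul] at this
  exact this

/-- Since the edge lies on an axis, positive and negative powers of `g` give points deep inside both
half-spaces. -/
theorem FreeEdge.isCut_trace {T : GATree A} {a b : T.V} (h : FreeEdge T a b) {g : G} {ℓ : ℕ}
    {γ : ℤ → T.V} (hγ : T.IsAxis g ℓ γ) (ha : γ 0 = a) (hb : γ 1 = b) :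
    IsCut A (trace T a b b) := by
  have hpos := hγ.pos
  have hz : ∀ n : ℤ, g ^ n • b = γ (1 + n * ℓ) := by
    intro n
    rw [← hb, hγ.zpow_smul]
  have hzz : ∀ n m : ℤ, g ^ n = g ^ m → n = m := by
    intro n m hnm
    have h1 := hz n
    rw [hnm, hz m] at h1
    have h2 := hγ.injective h1
    have h3 : n * ℓ = m * ℓ := by linarith
    exact mul_right_cancel₀ (by exact_mod_cast hpos.ne') h3
  have hin : ∀ n : ℕ, g ^ (n : ℤ) ∈ trace T a b b := by
    intro n
    rw [mem_trace, hz, ← ha, ← hb]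
    have h1 := hγ.dist_eq 0 (1 + n * ℓ)
    have h2 := hγ.dist_eq 1 (n * ℓ)
    push_cast at h1 h2
    rw [zero_add] at h1
    unfold Side
    rw [h1, h2]
    omega
  have hout : ∀ n : ℕ, g ^ (-(n + 1 : ℤ)) ∉ trace T a b b := by
    intro n
    rw [mem_trace, hz, ← ha, ← hb]
    obtain ⟨m, hm⟩ : ∃ m : ℕ, 1 + -(n + 1 : ℤ) * ℓ = -m := by
      refine ⟨(n + 1) * ℓ - 1, ?_⟩
      have : 1 ≤ (n + 1) * ℓ := Nat.succ_le_of_lt (by positivity)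
      push_cast [this]
      ring
    have h1 := hγ.dist_eq (-m) m
    have h2 := hγ.dist_eq (-m) (m + 1)
    rw [hm]
    unfold Side
    push_cast at h2
    rw [neg_add_cancel] at h1
    rw [neg_add_cancel_left] at h2
    rw [T.graph.dist_comm, h2, T.graph.dist_comm, h1]
    omega
  refine ⟨h.finiteSep_trace b, h.peripherallyElliptic_trace b, nested_trace h.1 b,
    ⟨g ^ ((0 : ℕ) : ℤ), g ^ ((1 : ℕ) : ℤ), fun he => ?_, hin 0, hin 1⟩,
    ⟨g ^ (-((0 : ℕ) + 1 : ℤ)), g ^ (-((1 : ℕ) + 1 : ℤ)), fun he => ?_, hout 0, hout 1⟩⟩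
  · have := hzz _ _ he
    norm_num at this
  · have := hzz _ _ he
    norm_num at this

section ToDual

variable {T : GATree A} {a b y : T.V} (hA : Ambient A) {H : Set G} (hH : IsCut A H)
  (hab : FreeEdge T a b) (hHy : H = trace T a b y)

-- Suppose that no point of the orbit of `y` lies in the corner of two walls that contains `u`.
-- Another corner is empty in all of `T` by nestedness, so the orbit misses two corners. Then either
-- a wall has an empty side or the walls agree up to complement, and neither is possible.
include hab hHy in
theorem isVertex_toDual (u : T.V) : (single hA hH).wallSpace.IsVertex
    {p : Unit × G | Side T.graph a b (p.2 • u)} := by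
  subst hHy
  have hmem : ∀ (p : Unit × G) x, p ∈ (single hA hH).wallSpace.pt x ↔
      Side T.graph a b (p.2 • (x • y)) := by
    intro p x
    rw [← mul_smul]
    rfl
  have hex : ∀ (p : Unit × G) (c : Prop), ∃ x, (c ↔ p ∈ (single hA hH).wallSpace.pt x) := by
    rintro ⟨⟨⟩, h⟩ c
    by_cases hc : c
    · obtain ⟨x, -, -, hx, -⟩ := hH.large
      refine ⟨h⁻¹ * x, ?_⟩
      rw [mem_pt, mul_inv_cancel_left]
      exact iff_of_true hc hx
    · obtain ⟨x, -, -, hx, -⟩ := hH.large_compl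
      refine ⟨h⁻¹ * x, ?_⟩
      rw [mem_pt, mul_inv_cancel_left]
      exact iff_of_false hc hx
  refine ⟨fun p q => ?_, fun x => ?_⟩
  · by_cases hpq : p = q
    · subst hpq
      obtain ⟨x, hx⟩ := hex p (p ∈ {p : Unit × G | Side T.graph a b (p.2 • u)})
      exact ⟨x, hx, hx⟩
    · by_contra hcon
      push Not at hcon
      obtain ⟨s, t, hst⟩ := nested_side_smul hab.1 p.2 q.2
      have hu := hst u
      obtain ⟨x1, hx1⟩ := (single hA hH).wallSpace.exists_ne p q hpq
      obtain ⟨x2, hx2⟩ := (single hA hH).wallSpace.exists_eq p q hpq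
      obtain ⟨x3, hx3⟩ := hex p s
      obtain ⟨x4, hx4⟩ := hex q t
      have k1 := hst (x1 • y)
      have k2 := hst (x2 • y)
      have k3 := hst (x3 • y)
      have k4 := hst (x4 • y)
      have l1 := hcon x1
      have l2 := hcon x2
      have l3 := hcon x3
      have l4 := hcon x4
      simp only [hmem, Set.mem_ofPred_eq] at *
      clear hst hcon hmem hex
      grind
  · refine finite_of_slices fun j => (hab.finite_sep u (x • y)).subset fun k hk => ?_
    simp only [Set.mem_ofPred_eq, hmem] at hk ⊢
    exact hk

/-- The vertex of the dual tree that a vertex of `T` is taken to by the collapse. -/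
def toDual (u : T.V) : (single hA hH).wallSpace.Vertex :=
  ⟨{p | Side T.graph a b (p.2 • u)}, isVertex_toDual hA hH hab hHy u⟩

theorem mem_toDual {u : T.V} {p : Unit × G} :
    p ∈ (toDual hA hH hab hHy u).1 ↔ Side T.graph a b (p.2 • u) := Iff.rfl

theorem toDual_smul (k : G) (u : T.V) :
    toDual hA hH hab hHy (k • u) = k • toDual hA hH hab hHy u := by
  apply Subtype.ext
  ext p
  rw [mem_smul, mem_toDual, mem_toDual, mul_smul]

theorem differsAt_toDual {u w : T.V} (huw : T.graph.Adj u w) {k : G}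
    (hk : s(k • u, k • w) = s(a, b)) :
    DiffersAt ((), k) (toDual hA hH hab hHy u).1 (toDual hA hH hab hHy w).1 := by
  rintro ⟨⟨⟩, k'⟩
  rw [mem_toDual, mem_toDual]
  constructor
  · rintro h he
    simp only [Prod.mk.injEq, true_and] at he
    subst he
    have hs : Side T.graph (k' • u) (k' • w) (k' • w) := side_right (T.adj_smul _ _ _ huw)
    exact not_side_iff_of_edge_eq hab.1 hs hk h
  · intro hne
    by_contra h
    have := edge_eq_of_not_side_iff hab.1 (T.adj_smul _ _ _ huw) h
    exact hne (Prod.ext rfl (hab.eq_of_smul_edge_eq this hk))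

theorem toDual_adj {u w : T.V} (huw : T.graph.Adj u w) :
    toDual hA hH hab hHy u = toDual hA hH hab hHy w ∨
      (single hA hH).wallSpace.graph.Adj (toDual hA hH hab hHy u) (toDual hA hH hab hHy w) := by
  by_cases h : ∀ k : G, Side T.graph a b (k • u) ↔ Side T.graph a b (k • w)
  · left
    apply Subtype.ext
    ext p
    exact h p.2
  · right
    push Not at h
    obtain ⟨k, hk⟩ := h
    refine ⟨((), k), differsAt_toDual hA hH hab hHy huw ?_⟩
    exact edge_eq_of_not_side_iff hab.1 (T.adj_smul _ _ _ huw) (by tauto)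

theorem surjective_toDual : Function.Surjective (toDual hA hH hab hHy) :=
  surjective_of_equivariant (T' := cutTree hA hH) _ (toDual_smul hA hH hab hHy)
    (fun _ _ h => toDual_adj hA hH hab hHy h)

theorem not_side_iff_of_dir {u w : T.V} (hne : u ≠ w) {k : G} (hab : T.graph.Adj a b)
    (hk : s(k • u, k • dir T.graph u w) = s(a, b)) :
    ¬ (Side T.graph a b (k • u) ↔ Side T.graph a b (k • w)) :=
  not_side_iff_of_edge_eq hab ((T.side_smul k).2 (side_dir T.isTree hne)) hk

theorem toDual_fibre (u w : T.V) (h : toDual hA hH hab hHy u = toDual hA hH hab hHy w) :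
    ∃ p : T.graph.Walk u w, ∀ v ∈ p.support,
      toDual hA hH hab hHy v = toDual hA hH hab hHy u := by
  induction hn : T.graph.dist u w generalizing u with
  | zero =>
    obtain rfl := (T.isTree.1.dist_eq_zero_iff).1 hn
    exact ⟨.nil, by simp⟩
  | succ n ih =>
    have hne : u ≠ w := by
      rintro rfl
      simp at hn
    have hd := dir_adj T.isTree hne
    have heq : toDual hA hH hab hHy (dir T.graph u w) = toDual hA hH hab hHy u := by
      rcases toDual_adj hA hH hab hHy hd with h1 | ⟨⟨⟨⟩, k⟩, h1⟩
      · exact h1.symm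
      · exfalso
        have h2 := h1.not_iff
        rw [mem_toDual, mem_toDual] at h2
        have h3 := edge_eq_of_not_side_iff hab.1 (T.adj_smul _ _ _ hd) h2
        apply not_side_iff_of_dir hne hab.1 h3
        have := congrArg (fun v => ((), k) ∈ v.1) h
        exact iff_of_eq this
    have hdist := (side_dir T.isTree hne).dist_eq T.isTree hd
    obtain ⟨p, hp⟩ := ih _ (heq.trans h) (by omega)
    refine ⟨.cons hd p, fun v hv => ?_⟩
    rw [SimpleGraph.Walk.support_cons, List.mem_cons] at hv
    rcases hv with rfl | hv
    · rfl
    · rw [hp v hv, heq]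

include hab hHy in
theorem collapses_cutTree_trace : T.Collapses (cutTree hA hH) :=
  collapses_of_walks (T' := cutTree hA hH) (toDual hA hH hab hHy) (toDual_smul hA hH hab hHy)
    (fun _ _ h => toDual_adj hA hH hab hHy h) (toDual_fibre hA hH hab hHy)

end ToDual

/-- All edges of `T` are in the orbit of any given one. -/
def OneEdge (T : GATree A) : Prop :=
  ∀ a b u w : T.V, T.graph.Adj a b → T.graph.Adj u w → ∃ k : G, s(k • a, k • b) = s(u, w)

theorem oneEdge_cutTree (hA : Ambient A) {H : Set G} (hH : IsCut A H) :
    OneEdge (cutTree hA hH) := by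
  rintro a b u w ⟨⟨⟨⟩, h⟩, hab⟩ ⟨⟨⟨⟩, h'⟩, huw⟩
  have hk := differsAt_smul hab (h'⁻¹ * h)
  simp only [mul_inv_rev, inv_inv, mul_inv_cancel_left] at hk
  refine ⟨h'⁻¹ * h, ?_⟩
  by_cases hs : ((), h') ∈ u.1 ↔ ((), h') ∈ ((h'⁻¹ * h) • a).1
  · have h1 := eq_of_differsAt huw hk hs
    have h2 := eq_of_differsAt_right huw hk hs
    exact Sym2.eq_iff.2 (Or.inl ⟨h1.symm, h2.symm⟩)
  · have hs' : ((), h') ∈ w.1 ↔ ((), h') ∈ ((h'⁻¹ * h) • a).1 := by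
      have := huw.not_iff
      tauto
    have h1 := eq_of_differsAt huw.symm hk hs'
    have h2 := eq_of_differsAt_right huw.symm hk hs'
    exact Sym2.eq_iff.2 (Or.inr ⟨h1.symm, h2.symm⟩)

section OneEdge

variable {T : GATree A} {a b y : T.V} (hA : Ambient A) {H : Set G} (hH : IsCut A H)
  (hab : FreeEdge T a b) (hHy : H = trace T a b y) (hT : OneEdge T)

include hT in
theorem OneEdge.exists_smul_edge (hab : T.graph.Adj a b) {u w : T.V} (huw : T.graph.Adj u w) :
    ∃ k : G, s(k • u, k • w) = s(a, b) := hT u w a b huw hab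

-- With one orbit of edges, the first edge from `u` towards `w` is a translate of the given one, so
-- its wall separates the images.
include hT in
theorem injective_toDual : Function.Injective (toDual hA hH hab hHy) := by
  intro u w h
  by_contra hne
  obtain ⟨k, hk⟩ := hT.exists_smul_edge hab.1 (dir_adj T.isTree hne)
  apply not_side_iff_of_dir hne hab.1 hk
  exact iff_of_eq (congrArg (fun v => ((), k) ∈ v.1) h)

include hT in
theorem adj_of_toDual_adj {u w : T.V} (h : (single hA hH).wallSpace.graph.Adj
    (toDual hA hH hab hHy u) (toDual hA hH hab hHy w)) : T.graph.Adj u w := by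
  have hne : u ≠ w := by
    rintro rfl
    exact h.ne rfl
  have hd := dir_adj T.isTree hne
  obtain ⟨k, hk⟩ := hT.exists_smul_edge hab.1 hd
  have h1 := differsAt_toDual hA hH hab hHy hd hk
  have h2 := not_side_iff_of_dir hne hab.1 hk
  obtain ⟨⟨⟨⟩, k'⟩, h3⟩ := h
  have h4 : k = k' := by
    by_contra hkk
    exact h2 (h3.iff_of_ne (q := ((), k)) (by simpa using hkk))
  subst h4
  have h5 := injective_toDual hA hH hab hHy hT (Subtype.ext (h1.eq_of_left h3))
  rwa [h5] at hd

end OneEdge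

/-- The vertex of `T` that corresponds to a choice of sides of the translates of one of its
edges. -/
theorem exists_vertexMap {J : Type} [Finite J] (C : CutFamily A J) (j : J) {T : GATree A}
    {a b y : T.V} (hab : FreeEdge T a b) (hHy : C.H j = trace T a b y) (hT : OneEdge T) :
    ∃ f : C.wallSpace.Vertex → T.V,
      (∀ ω (k : G), Side T.graph a b (k • f ω) ↔ (j, k) ∈ ω.1) ∧
      (∀ (k : G) ω, f (k • ω) = k • f ω) ∧
      (∀ ω ω', C.wallSpace.graph.Adj ω ω' → f ω = f ω' ∨ T.graph.Adj (f ω) (f ω')) ∧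
      ∀ ω ω', f ω = f ω' ↔ restrict C j ω = restrict C j ω' := by
  have hinj := injective_toDual C.ambient (C.cut j) hab hHy hT
  choose f hf using fun ω =>
    surjective_toDual C.ambient (C.cut j) hab hHy (restrict C j ω)
  refine ⟨f, fun ω k => ?_, fun k ω => ?_, fun ω ω' h => ?_, fun ω ω' => ?_⟩
  · have := congrArg (fun v => ((), k) ∈ v.1) (hf ω)
    exact iff_of_eq this
  · apply hinj
    rw [hf, toDual_smul, hf]
    rfl
  · rcases restrict_adj (j := j) h with h1 | h1
    · left
      apply hinj
      rw [hf, hf, h1]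
    · right
      rw [← hf, ← hf] at h1
      exact adj_of_toDual_adj _ _ _ _ hT h1
  · rw [← hf, ← hf]
    exact hinj.eq_iff.symm

theorem collapses_of_trace {J : Type} [Finite J] [Nonempty J] (C : CutFamily A J)
    (hC : C.NoMixedDegreeTwo) (j : J) {T : GATree A} {a b y : T.V} (hab : FreeEdge T a b)
    (hHy : C.H j = trace T a b y) (hT : OneEdge T) : (C.dual hC).Collapses T := by
  obtain ⟨f, -, h2, h3, h4⟩ := exists_vertexMap C j hab hHy hT
  refine collapses_of_walks (T := C.dual hC) f h2 h3 fun ω ω' h => ?_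
  obtain ⟨p, hp⟩ := restrict_fibre ((h4 ω ω').1 h)
  exact ⟨p, fun α hα => (h4 α ω).2 (hp α hα)⟩

/-- The distance of two vertices of a tree with one orbit of edges is at most the number of
translates of an edge separating them. -/
theorem OneEdge.dist_le {T : GATree A} {a b : T.V} (hab : FreeEdge T a b)
    (hT : OneEdge T) (u w : T.V) : T.graph.dist u w ≤
      {k : G | ¬ (Side T.graph a b (k • u) ↔ Side T.graph a b (k • w))}.ncard := by
  induction hn : T.graph.dist u w generalizing u with
  | zero => exact Nat.zero_le _
  | succ n ih =>
    have hne : u ≠ w := by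
      rintro rfl
      simp at hn
    have hd := dir_adj T.isTree hne
    have hdist := (side_dir T.isTree hne).dist_eq T.isTree hd
    have h1 := ih (dir T.graph u w) (by omega)
    obtain ⟨k, hk⟩ := hT.exists_smul_edge hab.1 hd
    have h2 := not_side_iff_of_dir hne hab.1 hk
    have h3 := not_side_iff_of_edge_eq hab.1 (side_right (T.adj_smul k _ _ hd)) hk
    have hlt : {k : G | ¬ (Side T.graph a b (k • dir T.graph u w) ↔
        Side T.graph a b (k • w))}.ncard <
        {k : G | ¬ (Side T.graph a b (k • u) ↔ Side T.graph a b (k • w))}.ncard := by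
      apply Set.ncard_lt_ncard _ (hab.finite_sep u w)
      refine ⟨fun k' hk' => ?_, fun hsub => ?_⟩
      · by_cases hkk : k' = k
        · subst hkk
          exact h2
        · have : Side T.graph a b (k' • u) ↔ Side T.graph a b (k' • dir T.graph u w) := by
            by_contra h
            exact hkk (hab.eq_of_smul_edge_eq
              (edge_eq_of_not_side_iff hab.1 (T.adj_smul _ _ _ hd) h) hk)
          simp only [Set.mem_ofPred_eq] at hk' ⊢
          rwa [this]
      · have h4 := hsub h2
        simp only [Set.mem_ofPred_eq] at h4
        tauto
    omega

end Traces

/-! ### Common refinements dual to two cuts -/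

section PairOfCuts

variable {G : Type u} [Group G] {ι : Type*} {A : ι → Subgroup G}

open WallSpace CutFamily

theorem Nested.translate {H U : Set G} (h : ∀ k : G, Nested (fun x => x ∈ H) (fun x => k * x ∈ U))
    (k : G) : Nested (fun x => x ∈ U) (fun x => k * x ∈ H) := by
  have := ((h k⁻¹).comp (fun x => k * x)).symm
  simp only [inv_mul_cancel_left] at this
  exact this

/-- The family of two cuts each of whose translates are nested but different. -/
def pairOfCuts (hA : Ambient A) {H U : Set G} (hH : IsCut A H) (hU : IsCut A U)
    (hn : ∀ k : G, Nested (fun x => x ∈ H) (fun x => k * x ∈ U))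
    (hne : ∀ k : G, ∃ x, ¬ (x ∈ H ↔ k * x ∈ U)) (heq : ∀ k : G, ∃ x, (x ∈ H ↔ k * x ∈ U)) :
    CutFamily A Bool where
  ambient := hA
  H j := if j then H else U
  cut j := by cases j <;> assumption
  nested := by
    rintro (_ | _) (_ | _) h
    · exact absurd rfl h
    · exact Nested.translate hn
    · exact hn
    · exact absurd rfl h
  exists_ne := by
    rintro (_ | _) (_ | _) h k
    · exact absurd rfl h
    · obtain ⟨x, hx⟩ := hne k⁻¹
      refine ⟨k⁻¹ * x, ?_⟩
      rw [mul_inv_cancel_left]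
      exact fun h => hx h.symm
    · exact hne k
    · exact absurd rfl h
  exists_eq := by
    rintro (_ | _) (_ | _) h k
    · exact absurd rfl h
    · obtain ⟨x, hx⟩ := heq k⁻¹
      refine ⟨k⁻¹ * x, ?_⟩
      rw [mul_inv_cancel_left]
      exact hx.symm
    · exact heq k
    · exact absurd rfl h

/-- At a vertex of degree two, any other vertex lies behind exactly one of the two edges. -/
theorem not_iff_of_degree_two {W X : Type*} [Nonempty X] {S : WallSpace W X} {v x y w : S.Vertex}
    {p q : W} (hv : S.graph.neighborSet v = {x, y}) (hx : DiffersAt p v.1 x.1)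
    (hy : DiffersAt q v.1 y.1) (hpq : p ≠ q) (hw : w ≠ v) :
    (p ∈ w.1 ↔ p ∈ v.1) ↔ ¬ (q ∈ w.1 ↔ q ∈ v.1) := by
  obtain ⟨r, v', hr, hrw⟩ := exists_flip hw.symm
  have hv' : v' = x ∨ v' = y := by
    have : v' ∈ S.graph.neighborSet v := ⟨r, hr⟩
    rwa [hv] at this
  have h1 : ¬ (p ∈ w.1 ↔ p ∈ v.1) ∨ ¬ (q ∈ w.1 ↔ q ∈ v.1) := by
    rcases hv' with rfl | rfl
    · rw [← hr.wall_unique hx]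
      left
      tauto
    · rw [← hr.wall_unique hy]
      right
      tauto
  -- The vertices `v`, `x` and `y` occupy three corners of `p` and `q`, so `w` cannot lie behind
  -- both edges.
  obtain ⟨s, t, hst⟩ := S.nested p q hpq
  obtain ⟨x1, hx1⟩ := v.2.1 p q
  obtain ⟨x2, hx2⟩ := x.2.1 p q
  obtain ⟨x3, hx3⟩ := y.2.1 p q
  obtain ⟨x4, hx4⟩ := w.2.1 p q
  have k1 := hst x1
  have k2 := hst x2
  have k3 := hst x3
  have k4 := hst x4
  have l1 := hx.not_iff
  have l2 := hx.iff_of_ne hpq.symm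
  have l3 := hy.not_iff
  have l4 := hy.iff_of_ne hpq
  simp only [← hx1.1, ← hx1.2, ← hx2.1, ← hx2.2, ← hx3.1, ← hx3.2, ← hx4.1, ← hx4.2] at k1 k2 k3 k4
  clear hst hx1 hx2 hx3 hx4 hr hrw hv
  grind

theorem not_iff_not_of_xor {p p' c q q' d : Prop} (h : (p ↔ c) ↔ ¬ (q ↔ d))
    (h' : (p' ↔ c) ↔ ¬ (q' ↔ d)) : ¬ (p ↔ p') ↔ ¬ (q ↔ q') := by
  grind

/-- If each vertex is moved by `g` across more translates of one cut than the number of translates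
of the other cut separating `1` from `g`, there is no mixed vertex of degree two. -/
theorem noMixedDegreeTwo_of_ncard_lt (C : CutFamily A Bool) {g : G} {ℓ : ℕ}
    (hlow : ∀ ω : C.wallSpace.Vertex,
      ℓ ≤ {k : G | ¬ ((true, k) ∈ ω.1 ↔ (true, k) ∈ (g • ω).1)}.ncard)
    (hup : {k : G | ¬ (k ∈ C.H false ↔ k * g ∈ C.H false)}.ncard < ℓ) : C.NoMixedDegreeTwo := by
  have key : ∀ (v x y : C.wallSpace.Vertex) (h₁ h₂ : G),
      C.wallSpace.graph.neighborSet v = {x, y} →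
      DiffersAt (true, h₁) v.1 x.1 → DiffersAt (false, h₂) v.1 y.1 → False := by
    intro v x y h₁ h₂ hv hx hy
    have hpq : ((true, h₁) : Bool × G) ≠ (false, h₂) := by simp
    have hadj : ∀ w, C.wallSpace.graph.Adj v w → w = x ∨ w = y := by
      intro w hw
      rwa [← SimpleGraph.mem_neighborSet, hv] at hw
    have hxor := fun w => not_iff_of_degree_two (w := w) hv hx hy hpq
    -- If no point of `G` were at `v`, the two walls would induce the same partition of `G`.
    obtain ⟨x₀, hx₀⟩ : ∃ x₀, C.wallSpace.point x₀ = v := by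
      by_contra hcon
      push Not at hcon
      obtain ⟨x1, hx1⟩ := C.wallSpace.exists_ne _ _ hpq
      obtain ⟨x2, hx2⟩ := C.wallSpace.exists_eq _ _ hpq
      have k1 := hxor _ (hcon x1)
      have k2 := hxor _ (hcon x2)
      change (_ ∈ C.wallSpace.pt x1 ↔ _) ↔ ¬ (_ ∈ C.wallSpace.pt x1 ↔ _) at k1
      change (_ ∈ C.wallSpace.pt x2 ↔ _) ↔ ¬ (_ ∈ C.wallSpace.pt x2 ↔ _) at k2
      clear hxor hcon hadj
      grind
    -- The orbit of `x` avoids `v`: otherwise the edge from `v` to `x` would be inverted, or taken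
    -- to one of the other type.
    have hnot : ∀ m : G, m • x ≠ v := by
      intro m hm
      have h1 : C.wallSpace.graph.Adj x v := ⟨_, hx.symm⟩
      have h2 := adj_smul h1 m
      rw [hm] at h2
      rcases hadj _ h2 with h3 | h3
      · have h4 := eq_one_of_smul_edge h1 (by rw [hm, h3, Sym2.eq_swap])
        rw [h4, one_smul] at h3
        exact h1.ne h3.symm
      · have h4 := differsAt_smul hx.symm m
        rw [hm, h3] at h4
        have := h4.wall_unique hy
        simp at this
    set z := x₀⁻¹ • x with hz
    have hz' : ∀ m : G, m • z ≠ v := by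
      intro m
      rw [hz, smul_smul]
      exact hnot _
    -- Away from `v` each of the two walls determines the other, so translates of both cuts separate
    -- `z` from `g • z` equally often, contrary to `hlow` and `hup`.
    have hcount : ∀ m : G, ¬ ((true, h₁ * m) ∈ z.1 ↔ (true, h₁ * m) ∈ (g • z).1) ↔
        ¬ ((false, h₂ * m) ∈ z.1 ↔ (false, h₂ * m) ∈ (g • z).1) := by
      intro m
      have k1 : ((true, h₁ * m) ∈ z.1 ↔ (true, h₁) ∈ v.1) ↔
          ¬ ((false, h₂ * m) ∈ z.1 ↔ (false, h₂) ∈ v.1) := hxor _ (hz' m)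
      have k2 : ((true, h₁ * m) ∈ (g • z).1 ↔ (true, h₁) ∈ v.1) ↔
          ¬ ((false, h₂ * m) ∈ (g • z).1 ↔ (false, h₂) ∈ v.1) :=
        hxor (m • g • z) (by rw [smul_smul]; exact hz' _)
      exact not_iff_not_of_xor k1 k2
    have hfalse : ∀ k, (false, k) ∈ z.1 ↔ k ∈ C.H false := by
      intro k
      rw [hz, mem_smul, ← hx.iff_of_ne (by simp), ← hx₀]
      change k * x₀⁻¹ * x₀ ∈ C.H false ↔ k ∈ C.H false
      rw [inv_mul_cancel_right]
    have hset : {k : G | ¬ (k ∈ C.H false ↔ k * g ∈ C.H false)} = (fun k => h₂ * (h₁⁻¹ * k)) ''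
        {k : G | ¬ ((true, k) ∈ z.1 ↔ (true, k) ∈ (g • z).1)} := by
      ext k
      have h1 := hcount (h₂⁻¹ * k)
      rw [mul_inv_cancel_left, mem_smul (k := g) (p := (false, k)), hfalse, hfalse] at h1
      constructor
      · intro h
        exact ⟨h₁ * (h₂⁻¹ * k), h1.2 h, by simp⟩
      · rintro ⟨k', hk', rfl⟩
        apply h1.1
        simpa using hk'
    have h1 := hlow z
    have hinj : Function.Injective fun k => h₂ * (h₁⁻¹ * k) :=
      (mul_right_injective h₂).comp (mul_right_injective h₁⁻¹)
    rw [hset, Set.ncard_image_of_injective _ hinj] at hup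
    omega
  rintro v x y ⟨j, h₁⟩ ⟨j', h₂⟩ hv hx hy
  cases j <;> cases j'
  · rfl
  · exact (key v y x _ _ (by rw [hv, Set.pair_comm]) hy hx).elim
  · exact (key v x y _ _ hv hx hy).elim
  · rfl

end PairOfCuts

/-! ### Blowing up a vertex of a one-edge splitting -/

section FirstEdge

variable {G : Type u} [Group G] {ι : Type*} {A : ι → Subgroup G}

open WallSpace CutFamily

open Classical in
/-- An element of `G` that takes the edge between `a` and `b` to the one between `u` and `w`. -/
noncomputable def edgeIndex (T : GATree A) (a b u w : T.V) : G :=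
  if h : ∃ k : G, s(k • a, k • b) = s(u, w) then h.choose else 1

open Classical in
/-- The index of the first edge on the way from the vertex `u` to the edge with index `x`,
inclusive. -/
noncomputable def firstEdge (T : GATree A) (a b u : T.V) (x : G) : G :=
  -- The direction is read off at the end `x • b`, hence the separate case. The other end gives the
  -- same edge when it differs from `u`.
  if x • b = u then x else edgeIndex T a b u (dir T.graph u (x • b))

variable {T : GATree A} {a b : T.V}

theorem edgeIndex_spec (hab : FreeEdge T a b) (hT : OneEdge T) {u w : T.V}
    (h : T.graph.Adj u w) :
    s(edgeIndex T a b u w • a, edgeIndex T a b u w • b) = s(u, w) := by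
  have : ∃ k : G, s(k • a, k • b) = s(u, w) := hT a b u w hab.1 h
  rw [edgeIndex, dif_pos this]
  exact this.choose_spec

theorem edgeIndex_eq (hab : FreeEdge T a b) {u w : T.V} {k : G}
    (h : s(k • a, k • b) = s(u, w)) : edgeIndex T a b u w = k := by
  have : ∃ k : G, s(k • a, k • b) = s(u, w) := ⟨k, h⟩
  rw [edgeIndex, dif_pos this]
  exact hab.eq_of_edge_eq (this.choose_spec.trans h.symm)

theorem edgeIndex_smul (hab : FreeEdge T a b) (hT : OneEdge T) {u w : T.V}
    (h : T.graph.Adj u w) (k : G) :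
    edgeIndex T a b (k • u) (k • w) = k * edgeIndex T a b u w := by
  apply edgeIndex_eq hab
  have := congrArg (Sym2.map fun v => k • v) (edgeIndex_spec hab hT h)
  simpa only [Sym2.map_mk, mul_smul] using this

theorem adj_smul_edge (hab : FreeEdge T a b) (x : G) : T.graph.Adj (x • a) (x • b) :=
  T.adj_smul x _ _ hab.1

theorem firstEdge_eq_edgeIndex (hab : FreeEdge T a b) {u p : T.V} {x : G}
    (hp : p ∈ s(x • a, x • b)) (hne : u ≠ p) :
    firstEdge T a b u x = edgeIndex T a b u (dir T.graph u p) := by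
  have hadj := adj_smul_edge hab x
  unfold firstEdge
  split_ifs with h
  · obtain rfl : p = x • a := by
      rcases Sym2.mem_iff.1 hp with h' | h'
      · exact h'
      · exact absurd (h'.trans h).symm hne
    rw [← h, dir_of_adj T.isTree hadj.symm]
    exact (edgeIndex_eq hab Sym2.eq_swap).symm
  · rcases Sym2.mem_iff.1 hp with rfl | rfl
    · rw [dir_congr_adj T.isTree hadj hne (Ne.symm h)]
    · rfl

theorem firstEdge_of_mem (hab : FreeEdge T a b) {u : T.V} {x : G} (hu : u ∈ s(x • a, x • b)) :
    firstEdge T a b u x = x := by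
  have hadj := adj_smul_edge hab x
  unfold firstEdge
  split_ifs with h
  · rfl
  · obtain rfl : u = x • a := by
      rcases Sym2.mem_iff.1 hu with h' | h'
      · exact h'
      · exact absurd h'.symm h
    rw [dir_of_adj T.isTree hadj]
    exact edgeIndex_eq hab rfl

theorem firstEdge_congr (hab : FreeEdge T a b) {u p : T.V} {x x' : G}
    (hp : p ∈ s(x • a, x • b)) (hp' : p ∈ s(x' • a, x' • b)) (hne : u ≠ p) :
    firstEdge T a b u x = firstEdge T a b u x' := by
  rw [firstEdge_eq_edgeIndex hab hp hne, firstEdge_eq_edgeIndex hab hp' hne]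

theorem firstEdge_smul (hab : FreeEdge T a b) (hT : OneEdge T) (u : T.V) (k x : G) :
    firstEdge T a b (k • u) (k * x) = k * firstEdge T a b u x := by
  by_cases h : x • b = u
  · have h' : (k * x) • b = k • u := by rw [mul_smul, h]
    rw [firstEdge, if_pos h', firstEdge, if_pos h]
  · have h' : ¬ (k * x) • b = k • u := by
      rw [mul_smul]
      exact fun h' => h (smul_left_cancel k h')
    rw [firstEdge, if_neg h', firstEdge, if_neg h, mul_smul, T.dir_smul k (Ne.symm h),
      edgeIndex_smul hab hT (dir_adj T.isTree (Ne.symm h))]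

theorem firstEdge_mul (hab : FreeEdge T a b) (hT : OneEdge T) (u : T.V) (k x : G) :
    firstEdge T a b u (k * x) = k * firstEdge T a b (k⁻¹ • u) x := by
  rw [← firstEdge_smul hab hT, smul_inv_smul]

/-- An edge not in the direction of `u'` as seen from `u` is seen from `u'` in the direction of `u`.
-/
theorem firstEdge_eq_or_eq (hab : FreeEdge T a b) {u u' : T.V} (hne : u ≠ u') (x : G) :
    firstEdge T a b u x = edgeIndex T a b u (dir T.graph u u') ∨
      firstEdge T a b u' x = edgeIndex T a b u' (dir T.graph u' u) := by
  have hd := dir_adj T.isTree hne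
  have hs := side_dir T.isTree hne
  have hmem : x • b ∈ s(x • a, x • b) := Sym2.mem_mk_right _ _
  by_cases h : Side T.graph u (dir T.graph u u') (x • b)
  · left
    have hxu : u ≠ x • b := by
      intro he
      rw [← he] at h
      exact not_side_left h
    rw [firstEdge_eq_edgeIndex hab hmem hxu, dir_eq T.isTree hd h]
  · right
    have hxu : u' ≠ x • b := by
      intro he
      rw [← he] at h
      exact h hs
    have h1 := (not_side_iff T.isTree hd).1 h
    have h2 : ¬ Side T.graph (dir T.graph u u') u u' := by
      rw [not_side_iff T.isTree hd.symm]
      exact hs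
    rw [firstEdge_eq_edgeIndex hab hmem hxu, dir_eq_of_side T.isTree hd.symm h2 h1]

theorem firstEdge_eq_of_side (hab : FreeEdge T a b) {u : T.V} {x : G}
    (h : ¬ (Side T.graph a b u ↔ Side T.graph a b (x • b))) :
    firstEdge T a b u x = firstEdge T a b u 1 := by
  have hmem : x • b ∈ s(x • a, x • b) := Sym2.mem_mk_right _ _
  have hu : u ≠ x • b := by
    rintro rfl
    exact h Iff.rfl
  rw [firstEdge_eq_edgeIndex hab hmem hu]
  by_cases hs : Side T.graph a b u
  · have ha : u ≠ a := by
      rintro rfl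
      exact not_side_left hs
    rw [firstEdge_eq_edgeIndex hab (p := a) (by simp) ha]
    have h1 : Side T.graph b a (x • b) := by
      rw [← not_side_iff T.isTree hab.1]
      tauto
    have h2 : ¬ Side T.graph b a u := by
      rw [not_side_iff T.isTree hab.1.symm]
      exact hs
    rw [dir_eq_of_side T.isTree hab.1.symm h2 h1]
  · have hb : u ≠ b := by
      rintro rfl
      exact hs (side_right hab.1)
    rw [firstEdge_eq_edgeIndex hab (p := b) (by simp) hb]
    rw [dir_eq_of_side T.isTree hab.1 hs (by tauto)]

/-- The elements of `G` that index the edges whose direction from the vertex `v` has index in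
`Q`. -/
def blowup (T : GATree A) (a b v : T.V) (Q : Set G) : Set G := {x | firstEdge T a b v x ∈ Q}

theorem mem_blowup {v : T.V} {Q : Set G} {x : G} :
    x ∈ blowup T a b v Q ↔ firstEdge T a b v x ∈ Q := Iff.rfl

/-- If `k` fixes `v`, both walls come from partitions of the edges at `v`, and nestedness of `Q`
applies. Otherwise every edge takes, at one of the two vertices, the colour of the direction of the
other vertex; the corner with both opposite colours is empty. -/
theorem nested_blowup (hab : FreeEdge T a b) (hT : OneEdge T) {Q : Set G}
    (hQ : ∀ k : G, Nested (fun x => x ∈ Q) (fun x => k * x ∈ Q)) (v : T.V) (k : G) :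
    Nested (fun x => x ∈ blowup T a b v Q) (fun x => k * x ∈ blowup T a b v Q) := by
  simp only [mem_blowup, firstEdge_mul hab hT v k]
  by_cases h : v = k⁻¹ • v
  · rw [← h]
    exact (hQ k).comp (firstEdge T a b v)
  · refine ⟨¬ edgeIndex T a b v (dir T.graph v (k⁻¹ • v)) ∈ Q,
      ¬ k * edgeIndex T a b (k⁻¹ • v) (dir T.graph (k⁻¹ • v) v) ∈ Q, fun x hx => ?_⟩
    dsimp only at hx
    rcases firstEdge_eq_or_eq hab h x with h1 | h1
    · rw [h1] at hx
      tauto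
    · rw [h1] at hx
      tauto

/-- All edges across the edge `a b` from the blown-up vertex are seen from it in one direction, so
they have one colour. -/
theorem nested_trace_blowup (hab : FreeEdge T a b) (hT : OneEdge T) (Q : Set G) (v : T.V) (k : G) :
    Nested (fun x => x ∈ trace T a b b) (fun x => k * x ∈ blowup T a b v Q) := by
  simp only [mem_blowup, firstEdge_mul hab hT v k, mem_trace]
  refine ⟨¬ Side T.graph a b (k⁻¹ • v), ¬ k * firstEdge T a b (k⁻¹ • v) 1 ∈ Q, fun x hx => ?_⟩
  dsimp only at hx
  rw [firstEdge_eq_of_side hab (u := k⁻¹ • v) (x := x) (by tauto)] at hx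
  tauto

/-- Adjacent edges can be distinguished only by blowing up their common vertex, and there they are
distinguished by `Q`. -/
theorem finite_sep_blowup_of_mem (hab : FreeEdge T a b) (hT : OneEdge T) {Q : Set G}
    (hQ : FiniteSep Q) (v : T.V) {p : T.V} {x y : G} (hx : p ∈ s(x • a, x • b))
    (hy : p ∈ s(y • a, y • b)) :
    {h | ¬ (h * x ∈ blowup T a b v Q ↔ h * y ∈ blowup T a b v Q)}.Finite := by
  refine (hQ x y).subset fun h hh => ?_
  simp only [mem_blowup, Set.mem_ofPred_eq, firstEdge_mul hab hT v h] at hh ⊢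
  by_cases hv : h⁻¹ • v = p
  · rwa [hv, firstEdge_of_mem hab hx, firstEdge_of_mem hab hy] at hh
  · rw [firstEdge_congr hab hx hy hv] at hh
    exact absurd Iff.rfl hh

theorem finiteSep_blowup (hab : FreeEdge T a b) (hT : OneEdge T) {Q : Set G}
    (hQ : FiniteSep Q) (v : T.V) : FiniteSep (blowup T a b v Q) := by
  have key : ∀ (p q : T.V) (w : T.graph.Walk p q) (x y : G), p ∈ s(x • a, x • b) →
      q ∈ s(y • a, y • b) →
      {h | ¬ (h * x ∈ blowup T a b v Q ↔ h * y ∈ blowup T a b v Q)}.Finite := by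
    intro p q w
    induction w with
    | nil => exact fun x y hx hy => finite_sep_blowup_of_mem hab hT hQ v hx hy
    | @cons p p' q hpp w ih =>
      intro x y hx hy
      have hz := edgeIndex_spec hab hT hpp
      set z := edgeIndex T a b p p'
      have h1 := finite_sep_blowup_of_mem hab hT hQ v hx
        (show p ∈ s(z • a, z • b) by rw [hz]; exact Sym2.mem_mk_left _ _)
      have h2 := ih z y (by rw [hz]; exact Sym2.mem_mk_right _ _) hy
      refine (h1.union h2).subset fun h hh => ?_
      simp only [Set.mem_union, Set.mem_ofPred_eq] at hh ⊢
      tauto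
  intro x y
  obtain ⟨w⟩ := T.isTree.1.preconnected (x • b) (y • b)
  exact key _ _ w x y (Sym2.mem_mk_right _ _) (Sym2.mem_mk_right _ _)

/-- The base point in the definition of `PeripherallyElliptic` can be changed. -/
theorem FiniteSep.exists_limit {H : Set G} (hH : FiniteSep H) {i : ι} {z : G} (z' : G) {L : Set G}
    (hL : ∀ h, {c : A i | ¬ (h * c * z ∈ H ↔ h ∈ L)}.Finite)
    (hL' : {h | ¬ (h * z ∈ H ↔ h ∈ L)}.Finite) :
    (∀ h, {c : A i | ¬ (h * c * z' ∈ H ↔ h ∈ L)}.Finite) ∧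
      {h | ¬ (h * z' ∈ H ↔ h ∈ L)}.Finite := by
  have hzz := hH z z'
  constructor
  · intro h
    have hinj : Function.Injective fun c : A i => h * (c : G) :=
      (mul_right_injective h).comp Subtype.val_injective
    refine ((hL h).union (hzz.preimage hinj.injOn)).subset fun c hc => ?_
    simp only [Set.mem_union, Set.mem_ofPred_eq, Set.mem_preimage] at hc ⊢
    tauto
  · refine (hL'.union hzz).subset fun h hc => ?_
    simp only [Set.mem_union, Set.mem_ofPred_eq] at hc ⊢
    tauto

theorem peripherallyElliptic_blowup (hab : FreeEdge T a b) (hT : OneEdge T) {Q : Set G}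
    (hQ : FiniteSep Q) (hQ' : PeripherallyElliptic A Q) (v : T.V) :
    PeripherallyElliptic A (blowup T a b v Q) := by
  intro i
  obtain ⟨u, hu⟩ := T.peripheral_fix i
  have := T.nontrivial
  obtain ⟨w, hw⟩ := T.isTree.1.preconnected.exists_adj_of_nontrivial u
  have hz := edgeIndex_spec hab hT hw
  set z := edgeIndex T a b u w
  have huz : u ∈ s(z • a, z • b) := by
    rw [hz]
    exact Sym2.mem_mk_left _ _
  have hmem : ∀ k : G, k • u ∈ s((k * z) • a, (k * z) • b) := fun k => by
    rw [mul_smul, mul_smul, Sym2.mem_iff]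
    exact (Sym2.mem_iff.1 huz).imp (congrArg (k • ·)) (congrArg (k • ·))
  obtain ⟨L, hL, hL'⟩ := hQ' i
  obtain ⟨k1, k2⟩ := hQ.exists_limit (z := 1) z (by simpa using hL) (by simpa using hL')
  have hinc : ∀ h : G, h • u = v → firstEdge T a b v (h * z) = h * z := by
    rintro h rfl
    rw [firstEdge_smul hab hT, firstEdge_of_mem hab huz]
  have hne : ∀ (h : G) (c : A i), h • u ≠ v →
      firstEdge T a b v (h * c * z) = firstEdge T a b v (h * z) := by
    intro h c hv
    refine firstEdge_congr hab (p := h • u) ?_ ?_ hv.symm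
    · have := hmem (h * c)
      rwa [mul_smul h c u, hu c c.2] at this
    · exact hmem h
  classical
  -- For `c` in `A i`, the edges `h * c * z` all meet `h • u`. If this vertex is `v` they keep their
  -- own colours, and the limit is that of `Q`; otherwise they have the same first edge from `v`.
  set L' : Set G := {h | if h • u = v then h ∈ L else h * z ∈ blowup T a b v Q}
  have k3 : ∀ h, {c : A i | ¬ (h * c * z ∈ blowup T a b v Q ↔ h ∈ L')}.Finite := by
    intro h
    by_cases hv : h • u = v
    · refine (k1 h).subset fun c hc => ?_
      have hv' : (h * c : G) • u = v := by rw [mul_smul, hu c c.2, hv]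
      simpa only [L', mem_blowup, Set.mem_ofPred_eq, if_pos hv, hinc _ hv'] using hc
    · refine Set.finite_empty.subset fun c hc => ?_
      simp [L', mem_blowup, hv, hne h c hv] at hc
  have k4 : {h | ¬ (h * z ∈ blowup T a b v Q ↔ h ∈ L')}.Finite := by
    refine k2.subset fun h hc => ?_
    by_cases hv : h • u = v
    · simpa only [L', mem_blowup, Set.mem_ofPred_eq, if_pos hv, hinc _ hv] using hc
    · simp [L', mem_blowup, hv] at hc
  obtain ⟨k5, k6⟩ := (finiteSep_blowup hab hT hQ v).exists_limit 1 k3 k4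
  simp only [mul_one] at k5 k6
  exact ⟨L', k5, k6⟩

end FirstEdge

/-! ### Colours of axes, mixed edges and the choice of the vertex -/

section Surgery

variable {G : Type u} [Group G] {ι : Type*} {A : ι → Subgroup G}

open WallSpace CutFamily GATree

/-- The index of the `n`-th edge of the path `γ` relative to its `0`-th edge. -/
noncomputable def lineEdge (T : GATree A) (γ : ℤ → T.V) (n : ℤ) : G :=
  edgeIndex T (γ 0) (γ 1) (γ n) (γ (n + 1))

/-- The edges that lie on two translates of the axis of different colours. -/
def mixedEdges (T : GATree A) (γ : ℤ → T.V) (ℓ : ℕ) (Q : Set G) : Set G :=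
  {x | ∃ n : ℕ, 0 < n ∧ n < ℓ ∧ ¬ (x * (lineEdge T γ n)⁻¹ ∈ Q ↔ x ∈ Q)}

variable {T : GATree A} {g : G} {ℓ : ℕ} {γ : ℤ → T.V} {Q : Set G}

theorem lineEdge_zero (hab : FreeEdge T (γ 0) (γ 1)) : lineEdge T γ 0 = 1 :=
  edgeIndex_eq hab (by simp)

theorem lineEdge_length (hab : FreeEdge T (γ 0) (γ 1)) (hγ : T.IsAxis g ℓ γ) :
    lineEdge T γ ℓ = g :=
  edgeIndex_eq hab (by rw [hγ.smul, hγ.smul, zero_add, add_comm 1])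

theorem smul_lineEdge (hab : FreeEdge T (γ 0) (γ 1)) (hT : OneEdge T) (hγ : T.IsAxis g ℓ γ)
    (h : G) (n : ℤ) :
    s((h * lineEdge T γ n) • γ 0, (h * lineEdge T γ n) • γ 1) = s(h • γ n, h • γ (n + 1)) := by
  have := congrArg (Sym2.map fun v => h • v) (edgeIndex_spec hab hT (hγ.adj n))
  simpa only [Sym2.map_mk, lineEdge, mul_smul] using this

theorem finite_mixedEdges (hQ : FiniteSep Q) : (mixedEdges T γ ℓ Q).Finite := by
  refine ((Set.finite_Ioo 0 ℓ).biUnion fun n _ => hQ (lineEdge T γ n)⁻¹ 1).subset ?_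
  rintro x ⟨n, h0, hℓ, hn⟩
  refine Set.mem_biUnion (Set.mem_Ioo.2 ⟨h0, hℓ⟩) ?_
  simpa only [Set.mem_ofPred_eq, mul_one] using hn

/-- An edge of the line `h • γ` that is not mixed has the colour of the line. -/
theorem mem_iff_of_notMem_mixedEdges (hab : FreeEdge T (γ 0) (γ 1)) (hγ : T.IsAxis g ℓ γ)
    (hg : ∀ x, x * g ∈ Q ↔ x ∈ Q) {h : G} {n : ℕ} (hn : n ≤ ℓ)
    (hm : 0 < n → n < ℓ → h * lineEdge T γ n ∉ mixedEdges T γ ℓ Q) :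
    h * lineEdge T γ n ∈ Q ↔ h ∈ Q := by
  rcases n.eq_zero_or_pos with rfl | h0
  · rw [Nat.cast_zero, lineEdge_zero hab, mul_one]
  rcases hn.eq_or_lt with rfl | hℓ
  · rw [lineEdge_length hab hγ, hg]
  by_contra hc
  refine hm h0 hℓ ⟨n, h0, hℓ, ?_⟩
  rw [mul_inv_cancel_right]
  tauto

/-- Along the edges of `h • γ` from `h` to `h * g`, the first edge from `v` can change only when the
line passes through `v`. If the edges there are unmixed, both have the colour of the line; so the
mixed edge `k` must be an interior edge of this segment. -/
theorem exists_eq_of_not_mem_blowup_iff (hab : FreeEdge T (γ 0) (γ 1)) (hT : OneEdge T)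
    (hγ : T.IsAxis g ℓ γ) (hg : ∀ x, x * g ∈ Q ↔ x ∈ Q) {v : T.V} {k : G}
    (hk : ∀ x ∈ mixedEdges T γ ℓ Q, v ∈ s(x • γ 0, x • γ 1) → x = k) {h : G}
    (hh : ¬ (h ∈ blowup T (γ 0) (γ 1) v Q ↔ h * g ∈ blowup T (γ 0) (γ 1) v Q)) :
    ∃ n : ℕ, 0 < n ∧ n < ℓ ∧ k * (lineEdge T γ n)⁻¹ = h := by
  by_contra! hc
  have hcol : ∀ n : ℕ, n ≤ ℓ → v ∈ s((h * lineEdge T γ n) • γ 0, (h * lineEdge T γ n) • γ 1) →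
      (firstEdge T (γ 0) (γ 1) v (h * lineEdge T γ n) ∈ Q ↔ h ∈ Q) := by
    intro n hn hv
    rw [firstEdge_of_mem hab hv]
    refine mem_iff_of_notMem_mixedEdges hab hγ hg hn fun h0 hℓ hm => hc n h0 hℓ ?_
    rw [← hk _ hm hv, mul_inv_cancel_right]
  have hstep : ∀ n : ℕ, n ≤ ℓ → (firstEdge T (γ 0) (γ 1) v (h * lineEdge T γ n) ∈ Q ↔
      firstEdge T (γ 0) (γ 1) v h ∈ Q) := by
    intro n
    induction n with
    | zero => rw [Nat.cast_zero, lineEdge_zero hab, mul_one]; exact fun _ => Iff.rfl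
    | succ n ih =>
      intro hn
      rw [← ih (by omega)]
      have h1 : h • γ ((n : ℤ) + 1) ∈
          s((h * lineEdge T γ n) • γ 0, (h * lineEdge T γ n) • γ 1) := by
        rw [smul_lineEdge hab hT hγ]
        exact Sym2.mem_mk_right _ _
      have h2 : h • γ ((n : ℤ) + 1) ∈ s((h * lineEdge T γ (n + 1 : ℕ)) • γ 0,
          (h * lineEdge T γ (n + 1 : ℕ)) • γ 1) := by
        rw [smul_lineEdge hab hT hγ]
        exact Sym2.mem_mk_left _ _
      by_cases hv : v = h • γ ((n : ℤ) + 1)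
      · rw [← hv] at h1 h2
        rw [hcol n (by omega) h1, hcol (n + 1) hn h2]
      · rw [firstEdge_congr hab h1 h2 hv]
  have := hstep ℓ le_rfl
  rw [lineEdge_length hab hγ] at this
  exact hh this.symm

theorem ncard_not_mem_blowup_iff_lt (hab : FreeEdge T (γ 0) (γ 1)) (hT : OneEdge T)
    (hγ : T.IsAxis g ℓ γ) (hg : ∀ x, x * g ∈ Q ↔ x ∈ Q) {v : T.V} {k : G}
    (hk : ∀ x ∈ mixedEdges T γ ℓ Q, v ∈ s(x • γ 0, x • γ 1) → x = k) :
    {h | ¬ (h ∈ blowup T (γ 0) (γ 1) v Q ↔ h * g ∈ blowup T (γ 0) (γ 1) v Q)}.ncard < ℓ := by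
  classical
  have hsub : {h | ¬ (h ∈ blowup T (γ 0) (γ 1) v Q ↔ h * g ∈ blowup T (γ 0) (γ 1) v Q)} ⊆
      ((Finset.Ioo 0 ℓ).image fun n : ℕ => k * (lineEdge T γ n)⁻¹ : Finset G) := by
    intro h hh
    obtain ⟨n, h0, hℓ, hn⟩ := exists_eq_of_not_mem_blowup_iff hab hT hγ hg hk hh
    simp only [Finset.coe_image, Finset.coe_Ioo, Set.mem_image, Set.mem_Ioo]
    exact ⟨n, ⟨h0, hℓ⟩, hn⟩
  have h1 := Set.ncard_le_ncard hsub (Finset.finite_toSet _)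
  rw [Set.ncard_coe_finset] at h1
  have h2 := h1.trans Finset.card_image_le
  rw [Nat.card_Ioo] at h2
  have := hγ.pos
  omega

/-- Some vertex meets edges of both colours. -/
theorem exists_vertex_two_colours (hab : FreeEdge T (γ 0) (γ 1)) (hT : OneEdge T) {x y : G}
    (hx : x ∈ Q) (hy : y ∉ Q) :
    ∃ (v : T.V) (k₁ k₂ : G), k₁ ∈ Q ∧ k₂ ∉ Q ∧ v ∈ s(k₁ • γ 0, k₁ • γ 1) ∧
      v ∈ s(k₂ • γ 0, k₂ • γ 1) := by
  by_contra! hc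
  have hiff : ∀ (p : T.V) (x y : G), p ∈ s(x • γ 0, x • γ 1) → p ∈ s(y • γ 0, y • γ 1) →
      (x ∈ Q ↔ y ∈ Q) := fun p x y hx hy =>
    ⟨fun h => by_contra fun h' => hc p x y h h' hx hy,
      fun h => by_contra fun h' => hc p y x h h' hy hx⟩
  have key : ∀ (p q : T.V) (w : T.graph.Walk p q) (x y : G), p ∈ s(x • γ 0, x • γ 1) →
      q ∈ s(y • γ 0, y • γ 1) → (x ∈ Q ↔ y ∈ Q) := by
    intro p q w
    induction w with
    | nil => exact hiff _
    | @cons p p' q hpp w ih =>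
      intro x y hx hy
      have hz := edgeIndex_spec hab hT hpp
      rw [← ih (edgeIndex T (γ 0) (γ 1) p p') y (by rw [hz]; exact Sym2.mem_mk_right _ _) hy]
      exact hiff p _ _ hx (by rw [hz]; exact Sym2.mem_mk_left _ _)
  obtain ⟨w⟩ := T.isTree.1.preconnected (x • γ 0) (y • γ 0)
  exact hy ((key _ _ w x y (Sym2.mem_mk_left _ _) (Sym2.mem_mk_left _ _)).1 hx)

/-- If there are mixed edges, some vertex meets exactly one of them. -/
theorem exists_vertex_one_mixedEdge (hab : FreeEdge T (γ 0) (γ 1)) (hQ : FiniteSep Q)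
    (hM : (mixedEdges T γ ℓ Q).Nonempty) :
    ∃ v : T.V, ∃ k ∈ mixedEdges T γ ℓ Q, v ∈ s(k • γ 0, k • γ 1) ∧
      ∀ x ∈ mixedEdges T γ ℓ Q, v ∈ s(x • γ 0, x • γ 1) → x = k := by
  obtain ⟨x, hx⟩ := hM
  -- At an endpoint farthest from `γ 0`, every mixed edge points towards `γ 0`, so there is only
  -- one.
  obtain ⟨v, hv, hmax⟩ := Set.Finite.exists_maximalFor (fun w => T.graph.dist w (γ 0))
    (⋃ x ∈ mixedEdges T γ ℓ Q, ({x • γ 0, x • γ 1} : Set T.V))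
    ((finite_mixedEdges hQ).biUnion fun x _ => Set.toFinite _)
    ⟨x • γ 0, Set.mem_biUnion hx (Set.mem_insert _ _)⟩
  simp only [Set.mem_iUnion, exists_prop, Set.mem_insert_iff, Set.mem_singleton_iff,
    ← Sym2.mem_iff] at hv hmax
  have hother : ∀ x ∈ mixedEdges T γ ℓ Q, v ∈ s(x • γ 0, x • γ 1) →
      ∃ w, s(x • γ 0, x • γ 1) = s(v, w) ∧ T.graph.Adj v w ∧ Side T.graph v w (γ 0) := by
    rintro x hx ⟨w, hw⟩
    have hvw : T.graph.Adj v w := by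
      have := adj_smul_edge hab x
      rwa [← SimpleGraph.mem_edgeSet, hw, SimpleGraph.mem_edgeSet] at this
    refine ⟨w, hw, hvw, ?_⟩
    by_contra hs
    rw [not_side_iff T.isTree hvw] at hs
    exact absurd (hmax ⟨x, hx, hw ▸ Sym2.mem_mk_right _ _⟩ hs.le) (not_le.2 hs)
  obtain ⟨k, hk, hvk⟩ := hv
  refine ⟨v, k, hk, hvk, fun x hx hvx => ?_⟩
  obtain ⟨w, h1, h2, h3⟩ := hother x hx hvx
  obtain ⟨w', h1', h2', h3'⟩ := hother k hk hvk
  obtain rfl := dir_unique T.isTree h2 h3 h2' h3'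
  exact hab.eq_of_edge_eq (h1.trans h1'.symm)

/-- Some vertex meets edges of both colours and at most one mixed edge. -/
theorem exists_blowup_vertex (hab : FreeEdge T (γ 0) (γ 1)) (hT : OneEdge T)
    (hγ : T.IsAxis g ℓ γ) (hQ : FiniteSep Q) (hg : ∀ x, x * g ∈ Q ↔ x ∈ Q) {x y : G}
    (hx : x ∈ Q) (hy : y ∉ Q) :
    ∃ (v : T.V) (k k₁ k₂ : G), k₁ ∈ Q ∧ k₂ ∉ Q ∧ v ∈ s(k₁ • γ 0, k₁ • γ 1) ∧
      v ∈ s(k₂ • γ 0, k₂ • γ 1) ∧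
      ∀ x ∈ mixedEdges T γ ℓ Q, v ∈ s(x • γ 0, x • γ 1) → x = k := by
  rcases (mixedEdges T γ ℓ Q).eq_empty_or_nonempty with hM | hM
  · obtain ⟨v, k₁, k₂, h1, h2, h3, h4⟩ := exists_vertex_two_colours hab hT hx hy
    -- Without mixed edges the value of `k` is irrelevant.
    refine ⟨v, 1, k₁, k₂, h1, h2, h3, h4, fun x hx => ?_⟩
    rw [hM] at hx
    exact hx.elim
  obtain ⟨v, k, hkM, hvk, hk⟩ := exists_vertex_one_mixedEdge hab hQ hM
  obtain ⟨n, h0, hℓ, hn⟩ := id hkM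
  obtain ⟨h, rfl⟩ : ∃ h, k = h * lineEdge T γ n := ⟨k * (lineEdge T γ n)⁻¹, by simp⟩
  rw [mul_inv_cancel_right] at hn
  have hnext : ∀ m : ℕ, m ≤ ℓ → m ≠ n →
      v ∈ s((h * lineEdge T γ m) • γ 0, (h * lineEdge T γ m) • γ 1) →
      (h * lineEdge T γ m ∈ Q ↔ h ∈ Q) := by
    intro m hm hmn hv
    refine mem_iff_of_notMem_mixedEdges hab hγ hg hm fun _ _ hmix => hmn ?_
    have he := hk _ hmix hv
    have h1 := smul_lineEdge hab hT hγ 1 m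
    have h2 := smul_lineEdge hab hT hγ 1 n
    rw [mul_left_cancel he, h2] at h1
    simp only [one_smul] at h1
    exact_mod_cast (hγ.eq_of_edge_eq h1).symm
  -- The line `h • γ`, whose colour differs from that of its mixed edge, continues through `v` to
  -- its edge `n - 1` or `n + 1`. As 0 < n < ℓ, this index is still between 0 and ℓ; the edge is
  -- unmixed or an end of the segment, so it has the colour of the line.
  obtain ⟨m, hm, hmn, hv⟩ : ∃ m : ℕ, m ≤ ℓ ∧ m ≠ n ∧
      v ∈ s((h * lineEdge T γ m) • γ 0, (h * lineEdge T γ m) • γ 1) := by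
    simp only [smul_lineEdge hab hT hγ] at hvk ⊢
    rcases Sym2.mem_iff.1 hvk with hv | hv
    · refine ⟨n - 1, by omega, by omega, ?_⟩
      rw [hv, Nat.cast_sub h0, Nat.cast_one, sub_add_cancel]
      exact Sym2.mem_mk_right _ _
    · refine ⟨n + 1, hℓ, by omega, ?_⟩
      rw [hv, Nat.cast_add, Nat.cast_one]
      exact Sym2.mem_mk_left _ _
  have hc := hnext m hm hmn hv
  by_cases hmQ : h * lineEdge T γ m ∈ Q
  · exact ⟨v, _, _, _, hmQ, by tauto, hv, hvk, hk⟩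
  · exact ⟨v, _, _, _, by tauto, hmQ, hvk, hv, hk⟩

/-- No edge of `T` ends at a leaf. -/
theorem exists_firstEdge_eq (hab : FreeEdge T (γ 0) (γ 1)) (hT : OneEdge T)
    (hγ : T.IsAxis g ℓ γ) {v : T.V} {k : G} (hv : v ∈ s(k • γ 0, k • γ 1)) :
    ∃ x, x ≠ k ∧ firstEdge T (γ 0) (γ 1) v x = k := by
  -- The line `k • γ` leaves the edge `k` at the end other than `v`; its next edge there lies behind
  -- `k` as seen from `v`.
  obtain ⟨n, hn, p, hvp, hp, hp'⟩ : ∃ n : ℤ, n ≠ 0 ∧ ∃ p : T.V, v ≠ p ∧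
      p ∈ s(k • γ 0, k • γ 1) ∧ p ∈ s((k * lineEdge T γ n) • γ 0, (k * lineEdge T γ n) • γ 1) := by
    simp only [smul_lineEdge hab hT hγ]
    have hne := (adj_smul_edge hab k).ne
    rcases Sym2.mem_iff.1 hv with rfl | rfl
    · exact ⟨1, one_ne_zero, k • γ 1, hne, Sym2.mem_mk_right _ _, Sym2.mem_mk_left _ _⟩
    · exact ⟨-1, by simp, k • γ 0, hne.symm, Sym2.mem_mk_left _ _, Sym2.mem_mk_right _ _⟩
  refine ⟨k * lineEdge T γ n, fun he => hn ?_, ?_⟩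
  · have h1 := smul_lineEdge hab hT hγ 1 n
    rw [mul_eq_left.1 he, one_mul, one_smul, one_smul, one_smul, one_smul] at h1
    exact (hγ.eq_of_edge_eq (m := 0) h1).symm
  · rw [firstEdge_congr hab hp' hp hvp, firstEdge_of_mem hab hv]

theorem isCut_blowup (hab : FreeEdge T (γ 0) (γ 1)) (hT : OneEdge T) (hγ : T.IsAxis g ℓ γ)
    (hQ : FiniteSep Q) (hQ' : PeripherallyElliptic A Q)
    (hn : ∀ k : G, Nested (fun x => x ∈ Q) (fun x => k * x ∈ Q)) {v : T.V} {k₁ k₂ : G}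
    (h1 : k₁ ∈ Q) (h2 : k₂ ∉ Q) (hv1 : v ∈ s(k₁ • γ 0, k₁ • γ 1))
    (hv2 : v ∈ s(k₂ • γ 0, k₂ • γ 1)) : IsCut A (blowup T (γ 0) (γ 1) v Q) where
  finiteSep := finiteSep_blowup hab hT hQ v
  peripherallyElliptic := peripherallyElliptic_blowup hab hT hQ hQ' v
  nested := nested_blowup hab hT hn v
  large := by
    obtain ⟨x, hx, hx'⟩ := exists_firstEdge_eq hab hT hγ hv1
    exact ⟨x, k₁, hx, by rwa [mem_blowup, hx'], by rwa [mem_blowup, firstEdge_of_mem hab hv1]⟩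
  large_compl := by
    obtain ⟨x, hx, hx'⟩ := exists_firstEdge_eq hab hT hγ hv2
    exact ⟨x, k₂, hx, by rwa [mem_blowup, hx'], by rwa [mem_blowup, firstEdge_of_mem hab hv2]⟩

end Surgery

/-! ### The surgery that shortens a simple element -/

section Shortening

variable {G : Type u} [Group G] {ι : Type*} {A : ι → Subgroup G}

open WallSpace CutFamily GATree

theorem freeEdge_of_edgeStab {T : GATree A} {a b : T.V} (hab : T.graph.Adj a b)
    (h : T.edgeStab a b = ⊥) : FreeEdge T a b := by
  refine ⟨hab, fun k hka hkb => ?_⟩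
  have : k ∈ T.edgeStab a b := Subgroup.mem_inf.2 ⟨hka, hkb⟩
  rwa [h, Subgroup.mem_bot] at this

theorem exists_smul_ne (S : GATree A) (y : S.V) : ∃ k : G, k • y ≠ y := by
  by_contra! hc
  have hS : ({y} : Set S.V) = Set.univ := by
    refine S.minimal {y} ?_ ?_
    · rw [SimpleGraph.induce_singleton_eq_top]
      exact SimpleGraph.connected_top
    · rintro k v rfl
      exact hc k
  have := S.nontrivial
  obtain ⟨z, hz⟩ := exists_ne y
  exact hz (hS.symm ▸ Set.mem_univ z : z ∈ ({y} : Set S.V))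

/-- An element that is elliptic in a tree with trivial edge stabilizers preserves a half-space of
`G` on the right. -/
theorem exists_invariant_halfspace {S : GATree A}
    (hS : ∀ v w, S.graph.Adj v w → S.edgeStab v w = ⊥) {g : G} (hg : S.Elliptic g) :
    ∃ Q : Set G, FiniteSep Q ∧ PeripherallyElliptic A Q ∧
      (∀ k : G, Nested (fun x => x ∈ Q) (fun x => k * x ∈ Q)) ∧ (∀ x, x * g ∈ Q ↔ x ∈ Q) ∧
      (∃ x, x ∈ Q) ∧ ∃ x, x ∉ Q := by
  obtain ⟨y, hy⟩ := hg
  obtain ⟨k, hk⟩ := exists_smul_ne S y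
  have hadj := dir_adj S.isTree hk.symm
  have hfree := freeEdge_of_edgeStab hadj (hS _ _ hadj)
  -- The base point `y` is fixed by `g`, which makes the half-space invariant under right
  -- multiplication by `g`.
  refine ⟨trace S y (dir S.graph y (k • y)) y, hfree.finiteSep_trace y,
    hfree.peripherallyElliptic_trace y, nested_trace hadj y, fun x => ?_,
    ⟨k, side_dir S.isTree hk.symm⟩, 1, ?_⟩
  · rw [mem_trace, mem_trace, mul_smul, hy]
  · rw [mem_trace, one_smul]
    exact not_side_left

theorem OneEdge.transLength_le_ncard {T : GATree A} {a b : T.V} (hab : FreeEdge T a b)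
    (hT : OneEdge T) (g : G) (u : T.V) : T.transLength g ≤
      {k : G | ¬ (Side T.graph a b (k • u) ↔ Side T.graph a b (k • g • u))}.ncard :=
  (T.transLength_le g u).trans (hT.dist_le hab u (g • u))

theorem transLength_cutTree_le (hA : Ambient A) {U : Set G} (hU : IsCut A U) (g : G) :
    (cutTree hA hU).transLength g ≤ {h | ¬ (h ∈ U ↔ h * g ∈ U)}.ncard := by
  refine ((cutTree hA hU).transLength_le g ((single hA hU).wallSpace.point 1)).trans ?_
  have h1 := (single hA hU).wallSpace.dist_le ((single hA hU).wallSpace.point 1)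
    (g • (single hA hU).wallSpace.point 1)
  refine h1.trans ?_
  have hfin : {h | ¬ (h ∈ U ↔ h * g ∈ U)}.Finite := by
    simpa only [mul_one] using hU.finiteSep 1 g
  refine Set.ncard_le_ncard_of_injOn Prod.snd ?_ ?_ hfin
  · rintro ⟨j, h⟩ hh
    rw [smul_point, mul_one] at hh
    change ¬ (h * 1 ∈ U ↔ h * g ∈ U) at hh
    rwa [mul_one] at hh
  · rintro ⟨j, h⟩ - ⟨j', h'⟩ - rfl
    rfl

/-- A translate of a half-space, or its complement, has the same number of walls separating `h` from
`h * g`. -/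
theorem ncard_le_of_translate {H U : Set G} (hU : FiniteSep U) (g k : G) {c : Prop}
    (h : ∀ x, (x ∈ H ↔ k * x ∈ U) ↔ c) :
    {h | ¬ (h ∈ H ↔ h * g ∈ H)}.ncard ≤ {h | ¬ (h ∈ U ↔ h * g ∈ U)}.ncard := by
  have hfin : {h | ¬ (h ∈ U ↔ h * g ∈ U)}.Finite := by simpa only [mul_one] using hU 1 g
  refine Set.ncard_le_ncard_of_injOn (k * ·) ?_ (mul_right_injective k).injOn hfin
  intro x hx
  have h1 := h x
  have h2 := h (x * g)
  rw [← mul_assoc] at h2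
  simp only [Set.mem_ofPred_eq] at hx ⊢
  tauto

theorem exists_shorter_cutTree (hA : Ambient A) {T : GATree A} (hT : OneEdge T)
    (hfree : ∀ v w, T.graph.Adj v w → T.edgeStab v w = ⊥) {S : GATree A}
    (hS : ∀ v w, S.graph.Adj v w → S.edgeStab v w = ⊥) {g : G} (hg : S.Elliptic g)
    (hpos : 0 < T.transLength g) :
    ∃ (U : Set G) (hU : IsCut A U), T.Compatible (cutTree hA hU) ∧
      (cutTree hA hU).transLength g < T.transLength g := by
  obtain ⟨γ, hγ⟩ := exists_isAxis hpos
  obtain ⟨Q, hQ, hQ', hn, hgQ, ⟨x, hx⟩, y, hy⟩ := exists_invariant_halfspace hS hg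
  have hadj : T.graph.Adj (γ 0) (γ 1) := hγ.adj 0
  have hab := freeEdge_of_edgeStab hadj (hfree _ _ hadj)
  obtain ⟨v, k, k₁, k₂, h1, h2, hv1, hv2, hk⟩ := exists_blowup_vertex hab hT hγ hQ hgQ hx hy
  have hlt := ncard_not_mem_blowup_iff_lt hab hT hγ hgQ hk
  have hU := isCut_blowup hab hT hγ hQ hQ' hn h1 h2 hv1 hv2
  have hH := hab.isCut_trace hγ rfl rfl
  set H := trace T (γ 0) (γ 1) (γ 1) with hHdef
  set U := blowup T (γ 0) (γ 1) v Q
  have hle : T.transLength g ≤ {h | ¬ (h ∈ H ↔ h * g ∈ H)}.ncard := by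
    have := hT.transLength_le_ncard hab g (γ 1)
    simpa only [H, mem_trace, mul_smul] using this
  -- Taking `c` true or false excludes that `H` is a translate of `U` or of its complement: the
  -- number of translates separating 1 from `g` is at least the translation length for `H` and
  -- smaller for `U`.
  have hno : ∀ (k : G) (c : Prop), ∃ x, ¬ ((x ∈ H ↔ k * x ∈ U) ↔ c) := fun k c => by
    by_contra! hc
    exact absurd (hle.trans (ncard_le_of_translate hU.finiteSep g k hc)) (not_le.2 hlt)
  let C := pairOfCuts hA hH hU (nested_trace_blowup hab hT Q v)
    (fun k => (hno k True).imp fun x hx => by tauto)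
    (fun k => (hno k False).imp fun x hx => by tauto)
  obtain ⟨f, hf, hfsmul, -⟩ := exists_vertexMap C true hab (y := γ 1) rfl hT
  have hC : C.NoMixedDegreeTwo := by
    refine noMixedDegreeTwo_of_ncard_lt C (fun ω => ?_) hlt
    have := hT.transLength_le_ncard hab g (f ω)
    rw [← hfsmul] at this
    simpa only [hf] using this
  exact ⟨U, hU, ⟨C.dual hC, collapses_of_trace C hC true hab rfl hT, collapses_cutTree C hC false⟩,
    (transLength_cutTree_le hA hU g).trans_lt hlt⟩

end Shortening

/-! ### Distances in the splitting graphs -/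

section Distances

variable {G : Type u} [Group G] {ι : Type*} {A : ι → Subgroup G}

open WallSpace CutFamily GATree

theorem GATree.Collapses.refl (T : GATree A) : T.Collapses T := by
  refine ⟨id, fun _ _ => rfl, fun _ _ h => Or.inr h, fun x => ?_⟩
  rw [Set.preimage_id, SimpleGraph.induce_singleton_eq_top]
  exact SimpleGraph.connected_top

theorem GATree.Collapses.transLength_le {T T' : GATree A} (h : T.Collapses T') (g : G) :
    T'.transLength g ≤ T.transLength g := by
  obtain ⟨f, hf, hadj, -⟩ := h
  have key : ∀ (u w : T.V) (p : T.graph.Walk u w), T'.graph.dist (f u) (f w) ≤ p.length := by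
    intro u w p
    induction p with
    | nil => simp
    | @cons u v w huv p ih =>
      rw [SimpleGraph.Walk.length_cons]
      rcases hadj u v huv with he | he
      · rw [he]
        exact ih.trans (Nat.le_succ _)
      · have h1 := T'.isTree.1.dist_triangle (u := f u) (v := f v) (w := f w)
        rw [SimpleGraph.dist_eq_one_iff_adj.2 he] at h1
        omega
  obtain ⟨v, hv⟩ := T.exists_dist_eq_transLength g
  obtain ⟨p, hp⟩ := T.isTree.1.exists_walk_length_eq_dist v (g • v)
  refine (T'.transLength_le g (f v)).trans ?_
  rw [← hf, ← hv, ← hp]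
  exact key _ _ p

variable {P : G → Prop}

theorem edist_le_one {T₀ T₁ : GATree A} (h₀ : T₀.IsZSplitting) (h₁ : T₁.IsZSplitting)
    (h : T₀.Compatible T₁ ∨ ∃ g : G, P g ∧ T₀.Elliptic g ∧ T₁.Elliptic g) :
    (splittingGraph A P).edist (ZVertex.mk T₀ h₀) (ZVertex.mk T₁ h₁) ≤ 1 := by
  rw [SimpleGraph.edist_le_one_iff_adj_or_eq]
  by_cases he : ZVertex.mk T₀ h₀ = ZVertex.mk T₁ h₁
  · exact Or.inr he
  · exact Or.inl ⟨he, T₀, T₁, h₀, h₁, rfl, rfl, h⟩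

theorem isFreeSplitting_cutTree (hA : Ambient A) {H : Set G} (hH : IsCut A H) :
    (cutTree hA hH).IsFreeSplitting := isFreeSplitting_dual _ _

/-- A free splitting with one orbit of edges is close to one in which a given simple element is
elliptic. -/
theorem exists_elliptic_edist_le (hA : Ambient A) {S : GATree A} (hS : S.IsFreeSplitting) {g : G}
    (hg : S.Elliptic g) (n : ℕ) {T : GATree A} (hT : T.IsFreeSplitting) (hone : OneEdge T)
    (hn : T.transLength g ≤ n) :
    ∃ (T' : GATree A) (hT' : T'.IsZSplitting), T'.Elliptic g ∧
      (splittingGraph A P).edist (ZVertex.mk T hT.1) (ZVertex.mk T' hT') ≤ n := by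
  induction n generalizing T with
  | zero =>
    exact ⟨T, hT.1, elliptic_of_transLength_eq_zero (Nat.le_zero.1 hn), by simp⟩
  | succ n ih =>
    rcases Nat.eq_zero_or_pos (T.transLength g) with h0 | hpos
    · exact ⟨T, hT.1, elliptic_of_transLength_eq_zero h0, by simp⟩
    obtain ⟨U, hU, hcomp, hlt⟩ := exists_shorter_cutTree hA hone hT.2 hS.2 hg hpos
    obtain ⟨T', hT', hell, hd⟩ := ih (isFreeSplitting_cutTree hA hU) (oneEdge_cutTree hA hU)
      (by omega)
    refine ⟨T', hT', hell, (SimpleGraph.edist_triangle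
      (v := ZVertex.mk _ (isFreeSplitting_cutTree hA hU).1)).trans ?_⟩
    rw [Nat.cast_succ, add_comm]
    exact add_le_add hd (edist_le_one hT.1 (isFreeSplitting_cutTree hA hU).1 (Or.inl hcomp))

/-- A Grushko tree in which a simple element is short is close to a free splitting in which it is
elliptic. -/
theorem exists_elliptic_edist_rescale_le (hA : Ambient A) {g : G} (hg : IsSimpleElt A g)
    {T : GATree A} (hT : T.IsGrushko) :
    ∃ ℓ : ℕ, (ℓ : ℕ∞) ≤ T.combLength g ∧ ∃ (T' : GATree A) (hT' : T'.IsZSplitting),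
      T'.Elliptic g ∧ (splittingGraph A P).edist
        (ZVertex.mk T.rescale hT.isZSplitting_rescale) (ZVertex.mk T' hT') ≤ (ℓ + 1 : ℕ) := by
  obtain ⟨hgA, S, hS, hgS⟩ := hg
  have hpos : 0 < T.rescale.transLength g := by
    refine Nat.pos_of_ne_zero fun h => ?_
    exact hT.1 g (elliptic_of_transLength_eq_zero h) hgA
  obtain ⟨γ, hγ⟩ := exists_isAxis hpos
  have hadj : T.rescale.graph.Adj (γ 0) (γ 1) := hγ.adj 0
  have hab := freeEdge_of_edgeStab hadj (hT.2 _ _ hadj)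
  have hH := hab.isCut_trace hγ rfl rfl
  have hcol := collapses_cutTree_trace (y := γ 1) hA hH hab rfl
  obtain ⟨T', hT', hell, hd⟩ := exists_elliptic_edist_le (P := P) hA hS hgS
    (T.rescale.transLength g) (isFreeSplitting_cutTree hA hH) (oneEdge_cutTree hA hH)
    (hcol.transLength_le g)
  refine ⟨_, hγ.le_combLength, T', hT', hell, (SimpleGraph.edist_triangle
    (v := ZVertex.mk _ (isFreeSplitting_cutTree hA hH).1)).trans ?_⟩
  rw [Nat.cast_succ, add_comm]
  exact add_le_add hd (edist_le_one _ _ (Or.inl ⟨_, Collapses.refl _, hcol⟩))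

/-- The property `P` is used only for the middle edge, between two splittings in which `g` is
elliptic. The standing assumptions are needed only if a Grushko tree exists, as otherwise the set is
empty. -/
theorem graphDiam_boundedLength_le
    (hA : (∃ T : GATree A, T.IsGrushko) → Ambient A) {g : G} (hg : IsSimpleElt A g) (hP : P g)
    (L : ℝ) (hL : 0 < L) :
    graphDiam (splittingGraph A P) (proj A '' boundedLength A L g) ≤
      ENNReal.ofReal (2 * L + 3) := by
  refine iSup₂_le fun x hx => iSup₂_le fun y hy => ?_
  obtain ⟨-, ⟨T, hT, rfl, hTL⟩, rfl⟩ := hx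
  obtain ⟨-, ⟨T', hT', rfl, hTL'⟩, rfl⟩ := hy
  have hA := hA ⟨T, hT⟩
  obtain ⟨ℓ, hℓ, S, hS, hgS, hd⟩ := exists_elliptic_edist_rescale_le (P := P) hA hg hT
  obtain ⟨ℓ', hℓ', S', hS', hgS', hd'⟩ := exists_elliptic_edist_rescale_le (P := P) hA hg hT'
  have hreal : ∀ {ℓ : ℕ} {T : GATree A}, (ℓ : ℕ∞) ≤ T.combLength g →
      (T.combLength g : ℝ≥0∞) ≤ ENNReal.ofReal L → (ℓ : ℝ) ≤ L := by
    intro ℓ T h h'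
    have := (ENat.toENNReal_le.2 h).trans h'
    rw [ENat.toENNReal_coe] at this
    rw [← ENNReal.ofReal_natCast] at this
    exact (ENNReal.ofReal_le_ofReal_iff hL.le).1 this
  have h1 := hreal hℓ hTL
  have h2 := hreal hℓ' hTL'
  have hdist : (splittingGraph A P).edist (proj A (OuterSpace.mk T hT))
      (proj A (OuterSpace.mk T' hT')) ≤ ((ℓ + 1 + (1 + (ℓ' + 1)) : ℕ) : ℕ∞) := by
    push_cast
    refine (SimpleGraph.edist_triangle (v := ZVertex.mk S hS)).trans
      (add_le_add (by exact_mod_cast hd) ?_)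
    refine (SimpleGraph.edist_triangle (v := ZVertex.mk S' hS')).trans (add_le_add ?_ ?_)
    · exact edist_le_one hS hS' (Or.inr ⟨g, hP, hgS, hgS'⟩)
    · rw [SimpleGraph.edist_comm]
      exact_mod_cast hd'
  refine (ENat.toENNReal_le.2 hdist).trans ?_
  rw [ENat.toENNReal_coe, ← ENNReal.ofReal_natCast]
  refine ENNReal.ofReal_le_ofReal ?_
  push_cast
  linarith

end Distances

/-! ### The standing assumptions for the free product -/

section FreeProducts

variable {k : ℕ} {A : Fin k → Type u} [∀ i, Group (A i)] {N : ℕ}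

open GATree

theorem of_mul_of_ne {ι : Type*} {M : ι → Type*} [∀ i, Monoid (M i)] {i j : ι} (hij : i ≠ j)
    {a : M i} {b : M j} (ha : a ≠ 1) (hb : b ≠ 1) :
    (Monoid.CoprodI.of a * Monoid.CoprodI.of b : Monoid.CoprodI M) ≠
      Monoid.CoprodI.of b * Monoid.CoprodI.of a := by
  classical
  intro h
  let w := Monoid.CoprodI.NeWord.append (.singleton a ha) hij (.singleton b hb)
  let w' := Monoid.CoprodI.NeWord.append (.singleton b hb) hij.symm (.singleton a ha)
  have hw : w.prod = w'.prod := by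
    simpa only [w, w', Monoid.CoprodI.NeWord.append_prod,
      Monoid.CoprodI.NeWord.prod_singleton] using h
  have := congrArg (fun v => v.toList.head?)
    (Monoid.CoprodI.Word.equiv.symm.injective (a₁ := w.toWord) (a₂ := w'.toWord) hw)
  simp only [Monoid.CoprodI.NeWord.toWord, Monoid.CoprodI.NeWord.toList_head?,
    Option.some.injEq, Sigma.mk.injEq] at this
  exact hij this.1

theorem freeGroup_of_mul_of_ne {X : Type*} {x y : X} (hxy : x ≠ y) :
    FreeGroup.of x * FreeGroup.of y ≠ FreeGroup.of y * FreeGroup.of x := by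
  classical
  intro h
  have := congrArg (FreeGroup.lift fun z =>
    if z = x then Equiv.swap (0 : Fin 3) 1 else Equiv.swap 1 2) h
  simp only [map_mul, FreeGroup.lift_apply_of, if_true, if_neg hxy.symm] at this
  exact absurd this (by decide)

theorem factor_injective (i : Fin k) :
    Function.Injective ((Monoid.Coprod.inl : Monoid.CoprodI A →* FreeProduct A N).comp
      (Monoid.CoprodI.of (i := i))) :=
  Monoid.Coprod.inl_injective.comp (Monoid.CoprodI.of_injective i)

/-- Non-sporadicity forces `2 ≤ N` or `2 ≤ k`, which gives two free generators or elements of two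
factors. -/
theorem exists_mul_ne_mul [∀ i, Nontrivial (A i)] (hξ : 3 ≤ complexity k N) :
    ∃ x y : FreeProduct A N, x * y ≠ y * x := by
  unfold complexity at hξ
  rcases le_or_gt 2 N with hN | hN
  · have hne : (⟨0, by omega⟩ : Fin N) ≠ ⟨1, by omega⟩ := by simp
    refine ⟨Monoid.Coprod.inr (.of ⟨0, by omega⟩), Monoid.Coprod.inr (.of ⟨1, by omega⟩), ?_⟩
    rw [← map_mul, ← map_mul]
    exact fun h => freeGroup_of_mul_of_ne hne (Monoid.Coprod.inr_injective h)
  · have hne : (⟨0, by omega⟩ : Fin k) ≠ ⟨1, by omega⟩ := by simp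
    obtain ⟨a, ha⟩ := exists_ne (1 : A ⟨0, by omega⟩)
    obtain ⟨b, hb⟩ := exists_ne (1 : A ⟨1, by omega⟩)
    refine ⟨Monoid.Coprod.inl (.of a), Monoid.Coprod.inl (.of b), ?_⟩
    rw [← map_mul, ← map_mul]
    exact fun h => of_mul_of_ne hne ha hb (Monoid.Coprod.inl_injective h)

/-- Torsion elements are elliptic in a Grushko tree, and so they are peripheral. -/
theorem ambient_factor [∀ i, Infinite (A i)]
    (hA : ∀ (i : Fin k) (a : A i), a ≠ 1 → ¬ IsOfFinOrder a) (hξ : 3 ≤ complexity k N)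
    {T : GATree (factor A N)} (hT : T.IsGrushko) : Ambient (factor A N) where
  torsionFree x hx hfin := by
    refine hT.1 x (T.elliptic_of_isOfFinOrder hfin) ⟨hx, ?_⟩
    rintro i c ⟨a, ha⟩
    have h1 : IsOfFinOrder (c * x * c⁻¹) := by
      have := (MulAut.conj c).toMonoidHom.isOfFinOrder hfin
      simpa using this
    have h2 : c * x * c⁻¹ ≠ 1 := by
      intro h
      exact hx (by simpa using h)
    rw [← ha] at h1 h2
    refine hA i a (fun h => h2 (by rw [h, map_one])) ?_
    exact (factor_injective i).isOfFinOrder_iff.1 h1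
  infinite i := Infinite.of_injective _
    (MonoidHom.rangeRestrict_injective_iff.2 (factor_injective i))
  noncomm := exists_mul_ne_mul hξ

end FreeProducts

end GrushkoTrees

open GrushkoTrees

theorem proposition5p1 {k : ℕ} (A : Fin k → Type u) [∀ i, Group (A i)]
    [∀ i, Countable (A i)] [∀ i, Infinite (A i)]
    (hA : ∀ (i : Fin k) (a : A i), a ≠ 1 → ¬ IsOfFinOrder a)
    (N : ℕ) (hξ : 3 ≤ complexity k N)
    (L : ℝ) (hL : 0 < L) (g : FreeProduct A N) (hg : IsSimpleElt (factor A N) g) :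
    graphDiam (ZFactorGraph (factor A N)) (proj (factor A N) '' boundedLength (factor A N) L g)
        ≤ ENNReal.ofReal (2 * L + 3) ∧
      graphDiam (FreeFactorGraph (factor A N))
          (proj (factor A N) '' boundedLength (factor A N) L g)
        ≤ ENNReal.ofReal (2 * L + 3) :=
  have hamb : (∃ T : GATree (factor A N), T.IsGrushko) → Ambient (factor A N) :=
    fun ⟨_, hT⟩ => ambient_factor hA hξ hT
  ⟨graphDiam_boundedLength_le hamb hg hg.1 L hL, graphDiam_boundedLength_le hamb hg hg L hL⟩
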